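/- Let $K$ be an oriented knot diagram on the sphere whose arcs are colored by a quandle $X$ (each arc carries an element of $X$, subject to the quandle relation at each crossing; equivalently, this is a homomorphism to $X$ from the fundamental quandle of the knot). Suppose that the coloring is non-trivial, i.e. uses more than one color, and that two distinct arcs $a \neq b$ have the same color $x \in X$. Then a finite sequence of Reidemeister moves of type II, with the coloring carried along (colors away from each move are unchanged), leads to an equivalent, again non-trivially colored diagram $K'$ with two distinct arcs $a' \ne b'$, both of color $x$, such that cutting $a'$ and $b'$ at one suitable point each yields a diagram of a 2-tangle in a disc (the two cut points being on the boundary of a common face of $K'$) whose two components have non-zero linking number. Here the linking number of a 2-tangle diagram is half the sum of the signs of the crossings between its two components, which are oriented by the orientation of the knot. -/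

import Mathlib

open Quandles

namespace KnotTangle

/-! ### Crossings

A crossing of an oriented diagram is passed through twice, once along its over-strand and once along
its under-strand. For a set `C` of crossings the *passages* are the elements of `C × Bool`:
`(c, true)` is the over-passage of `c` and `(c, false)` its under-passage. -/

/-- The other passage through the same crossing. -/
def other {C : Type} (y : C × Bool) : C × Bool := (y.1, !y.2)

/-- At passage `y`, the other strand of the crossing goes from the right of the strand of `y` to
its left. (At a positive crossing the under-strand crosses the over-strand from right to left, hence
the over-strand crosses the under-strand from left to right; a negative crossing is the mirror
image.) -/
abbrev CrossedLeftward {C : Type} (sign : C → ℤˣ) (y : C × Bool) : Prop :=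
  sign y.1 = if y.2 then 1 else -1

/-! ### Oriented knot diagrams on the sphere -/

/-- A signed Gauss code: crossings with their signs, and for each passage the following passage in
the direction of the orientation. The *edges* (segments of the curve between consecutive passages)
are indexed by passages too: the edge `x` runs from passage `x` to passage `next x`. -/
structure GaussCode where
  Crossing : Type
  [fintypeCrossing : Fintype Crossing]
  [decEqCrossing : DecidableEq Crossing]
  sign : Crossing → ℤˣ
  next : Equiv.Perm (Crossing × Bool)

attribute [instance] GaussCode.fintypeCrossing GaussCode.decEqCrossing

namespace GaussCode

variable (D : GaussCode)

/-- Edges, indexed by the passage at which they start. -/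
abbrev Edge : Type := D.Crossing × Bool

/-- Walk along the boundary of a face, keeping the face on the left. The state `(x, true)` means
walking along edge `x` in its direction, `(x, false)` means walking along edge `x` against its
direction. At the end of the edge one turns left at the crossing. -/
def faceStep : D.Edge × Bool → D.Edge × Bool
  | (x, true) =>
      let y := D.next x
      if CrossedLeftward D.sign y then (other y, true) else (D.next.symm (other y), false)
  | (x, false) =>
      if CrossedLeftward D.sign x then (D.next.symm (other x), false) else (other x, true)

/-- The faces: the orbits of the boundary walk. -/
def Face : Type := Quot fun s t : D.Edge × Bool => t = D.faceStep s

/-- The arcs: an edge and the next one belong to the same arc if the passage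
between them is an over-passage. -/
def Arc : Type := Quot fun x y : D.Edge => y = D.next x ∧ y.2 = true

/-- The arc that contains a given edge. -/
def arcOf (x : D.Edge) : D.Arc := Quot.mk _ x

end GaussCode

/-- An oriented knot diagram on the sphere, up to isotopy of the sphere, with at least one crossing
(the circle without crossings has only one arc): a signed Gauss code that consists of one closed
curve and that satisfies Euler's formula `V + F = E + 2` of a cellular decomposition of the
sphere. -/
structure KnotDiagram extends GaussCode where
  one_component : ∀ x y, next.SameCycle x y
  planar : Fintype.card Crossing + Nat.card toGaussCode.Face
    = Fintype.card (Crossing × Bool) + 2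

/-! ### Colorings by quandles -/

/-- A knot diagram with a coloring by a quandle `X` : each arc has a color, and at each crossing
the color of the under-arc on the left of the over-arc is the result of the action of the color of
the over-arc on the color of the under-arc on its right. (Equivalently, a quandle homomorphism to `X`
from the fundamental quandle, which is presented by these generators and relations.) -/
structure ColoredDiagram (X : Type*) [Quandle X] where
  diagram : KnotDiagram
  color : diagram.Arc → X
  pos : ∀ c, diagram.sign c = 1 →
    color (diagram.arcOf (c, false)) =
      color (diagram.arcOf (c, true)) ◃ color (diagram.arcOf (diagram.next.symm (c, false)))
  neg : ∀ c, diagram.sign c = -1 →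
    color (diagram.arcOf (diagram.next.symm (c, false))) =
      color (diagram.arcOf (c, true)) ◃ color (diagram.arcOf (c, false))

/-- More than one color is used. -/
def ColoredDiagram.IsNontrivial {X : Type*} [Quandle X] (K : ColoredDiagram X) : Prop :=
  ∃ a b, K.color a ≠ K.color b

/-! ### Reidemeister moves of type II -/

/-- `D'` arises from `D` by a Reidemeister II move that creates two crossings `c₁`, `c₂`:
they have opposite signs, one strand passes over both of them consecutively and the other strand
passes under both of them consecutively (in the same or in the opposite order), so that the two
strands bound a bigon; deleting `c₁` and `c₂` from `D'` leaves `D`. -/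
structure R2Creation (D D' : KnotDiagram) where
  c₁ : D'.Crossing
  c₂ : D'.Crossing
  sign_ne : D'.sign c₁ ≠ D'.sign c₂
  over_consecutive : D'.next (c₁, true) = (c₂, true)
  under_consecutive : D'.next (c₁, false) = (c₂, false) ∨ D'.next (c₂, false) = (c₁, false)
  /-- the inclusion of the old crossings -/
  incl : D.Crossing → D'.Crossing
  incl_injective : Function.Injective incl
  range_incl : ∀ c, c ∈ Set.range incl ↔ c ≠ c₁ ∧ c ≠ c₂
  sign_incl : ∀ c, D'.sign (incl c) = D.sign c
  /-- between consecutive old passages there are only new passages -/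
  next_incl : ∀ x : D.Crossing × Bool, ∃ k : ℕ,
    D'.next^[k + 1] (incl x.1, x.2) = (incl (D.next x).1, (D.next x).2) ∧
    ∀ j < k, (D'.next^[j + 1] (incl x.1, x.2)).1 = c₁ ∨
      (D'.next^[j + 1] (incl x.1, x.2)).1 = c₂

/-- A colored Reidemeister II move that creates two crossings: the colors of the old edges, at their
starting points, do not change. (The remaining colors are determined by these.) -/
def ColoredR2Creation {X : Type*} [Quandle X] (K K' : ColoredDiagram X) : Prop :=
  ∃ m : R2Creation K.diagram K'.diagram, ∀ x : K.diagram.Edge,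
    K'.color (K'.diagram.arcOf (m.incl x.1, x.2)) = K.color (K.diagram.arcOf x)

/-- A colored Reidemeister II move, in either direction. -/
def ColoredR2Move {X : Type*} [Quandle X] (K K' : ColoredDiagram X) : Prop :=
  ColoredR2Creation K K' ∨ ColoredR2Creation K' K

/-! ### Diagrams of 2-tangles -/

/-- The combinatorial data of an oriented tangle diagram in a disc whose strands are indexed by
`Bool`. The edges are indexed by the points where they start: `inl y` is a passage and `inr i` is
the initial endpoint of strand `i`. The edge `x` ends at `next x`, where `inl y` is a passage and
`inr i` now stands for the terminal endpoint of strand `i`. The endpoints on the boundary circle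
of the disc are the pairs `(i, true)` (initial) and `(i, false)` (terminal), and `boundaryNext`
sends an endpoint to the next one in counterclockwise order. -/
structure TangleCode where
  Crossing : Type
  [fintypeCrossing : Fintype Crossing]
  [decEqCrossing : DecidableEq Crossing]
  sign : Crossing → ℤˣ
  next : Equiv.Perm ((Crossing × Bool) ⊕ Bool)
  boundaryNext : Equiv.Perm (Bool × Bool)

attribute [instance] TangleCode.fintypeCrossing TangleCode.decEqCrossing

namespace TangleCode

variable (T : TangleCode)

abbrev Edge : Type := (T.Crossing × Bool) ⊕ Bool

/-- Enter the disc at an endpoint: along the initial edge of a strand in its direction, or along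
the terminal edge of a strand against its direction. -/
def enter : Bool × Bool → T.Edge × Bool
  | (i, true) => (.inr i, true)
  | (i, false) => (T.next.symm (.inr i), false)

/-- Walk along the boundary of a region, keeping the region on the left, as for knot diagrams;
from an endpoint one proceeds along the boundary circle to the next endpoint and enters the disc
again there. -/
def faceStep : T.Edge × Bool → T.Edge × Bool
  | (x, true) =>
      match T.next x with
      | .inl y =>
          if CrossedLeftward T.sign y then (.inl (other y), true)
          else (T.next.symm (.inl (other y)), false)
      | .inr i => T.enter (T.boundaryNext (i, false))
  | (.inl y, false) =>
      if CrossedLeftward T.sign y then (T.next.symm (.inl (other y)), false)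
      else (.inl (other y), true)
  | (.inr i, false) => T.enter (T.boundaryNext (i, true))

/-- The regions into which the diagram divides the disc. -/
def Face : Type := Quot fun s t : T.Edge × Bool => t = T.faceStep s

end TangleCode

/-- A diagram of a 2-tangle: two oriented strands in a disc, strand `i` running from its initial to
its terminal endpoint, and no closed components. In the permutation `next` the two ends of each
strand are identified, so it has two cycles, one for each strand. Planarity is expressed by Euler's
formula `V + F = E + 2` for the sphere that arises from the disc by collapsing the boundary circle
to a vertex of degree four. -/
structure TwoTangleDiagram extends TangleCode where
  two_strands : ¬ next.SameCycle (.inr false) (.inr true)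
  no_closed_component : ∀ x, ∃ i, next.SameCycle (.inr i) x
  boundary_cyclic : ∀ a b, boundaryNext.SameCycle a b
  planar : (Fintype.card Crossing + 1) + Nat.card toTangleCode.Face
    = Fintype.card ((Crossing × Bool) ⊕ Bool) + 2

open Classical in
/-- The linking number of the two components of a 2-tangle: half the sum of the signs of the
crossings at which the two passages belong to different strands. -/
noncomputable def TwoTangleDiagram.linkingNumber (T : TwoTangleDiagram) : ℚ :=
  (∑ c : T.Crossing, if T.next.SameCycle (.inl (c, true)) (.inl (c, false)) then 0
    else ((T.sign c : ℤ) : ℚ)) / 2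

/-- `T` arises from the knot diagram `D` by cutting the edges `e` and `f` at one point each, `T`
being drawn in the complement of a small disc that meets the curve of `D` only in a neighborhood of
the two points. Strand `false` runs from the cut of `e` to the cut of `f`, and strand `true` from the
cut of `f` to the cut of `e`. The two ends at each cut are neighbors on the boundary circle. -/
structure IsCut (D : KnotDiagram) (e f : D.Edge) (T : TwoTangleDiagram) where
  equiv : D.Crossing ≃ T.Crossing
  sign_equiv : ∀ c, T.sign (equiv c) = D.sign c
  start_false : T.next (.inr false) = .inl (equiv (D.next e).1, (D.next e).2)
  end_false : T.next (.inl (equiv f.1, f.2)) = .inr false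
  start_true : T.next (.inr true) = .inl (equiv (D.next f).1, (D.next f).2)
  end_true : T.next (.inl (equiv e.1, e.2)) = .inr true
  next_equiv : ∀ x, x ≠ e → x ≠ f →
    T.next (.inl (equiv x.1, x.2)) = .inl (equiv (D.next x).1, (D.next x).2)
  /-- the ends at the cut of `e` are the terminal end of strand `true` and the initial end of
  strand `false` -/
  adjacent_e : T.boundaryNext (true, false) = (false, true) ∨
    T.boundaryNext (false, true) = (true, false)
  /-- the ends at the cut of `f` are the terminal end of strand `false` and the initial end of
  strand `true` -/
  adjacent_f : T.boundaryNext (false, false) = (true, true) ∨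
    T.boundaryNext (true, true) = (false, false)

end KnotTangle

/-! Let `e₀` be an edge of the arc `a`. On one of its sides it is followed, along the face there, by
another edge `g`. A first move pushes `g` over `e₀` across this face and divides `e₀` into three
pieces. The two new crossings act on the color of `e₀` by inverse operations, so the first piece `q`
and the last piece `p` both keep the color `x`. Both border the face into which `g` has been pushed,
and a second move pushes `p` over `q` across that face. Let `e` be the last piece of `q` and `f` the
middle piece of `p`. Both have color `x`. The edge `e` runs from an under-passage to an
under-passage, so it is a whole arc and `f` belongs to another one. The strand from a cut of `e` to
a cut of `f` is short: it passes twice under `g`, at crossings of opposite sign, and then once over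
`q`. The other passages at these three crossings are on the other strand, so the linking number is
`1 / 2` or `-1 / 2`. Most of the work is to show that pushing and cutting preserve planarity. Faces
are orbits of the boundary walk. Both operations interchange, up to detours, the successors of two
darts (directed edges) of one face, and composing a permutation with a transposition of two elements
of a cycle splits this cycle (`card_orbits_comp_swap`). Together with the bigon in the case of a
push, this gives `card_face_push` and `card_face_cut`, hence Euler's formula. The colors after a
push are those of `pushColorFun`, `linkingNumber_cut` computes the linking number from a set of
passages, and `exists_moves_of_edge` assembles the construction. -/

namespace KnotTangle

/-! ### Orbits of a map and the splitting of a cycle by a transposition -/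

section Orbits

variable {α : Type*}

/-- The orbits of a map. -/
def Orbits (f : α → α) : Type _ := Quot fun s t : α => t = f s

namespace Orbits

variable {β γ : Type*} {f : α → α} {g : β → β}

/-- The orbit of an element. -/
def mk (f : α → α) (x : α) : Orbits f := Quot.mk _ x

@[simp] theorem mk_apply (f : α → α) (x : α) : mk f (f x) = mk f x :=
  (Quot.sound (r := fun s t : α => t = f s) rfl).symm

theorem exists_mk (q : Orbits f) : ∃ x, mk f x = q := Quot.exists_rep q

/-- The map on orbits induced by an invariant map. -/
def lift (F : α → γ) (h : ∀ x, F (f x) = F x) : Orbits f → γ :=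
  Quot.lift F (by rintro x _ rfl; exact (h x).symm)

@[simp] theorem lift_mk (F : α → γ) (h : ∀ x, F (f x) = F x) (x : α) :
    lift F h (mk f x) = F x := rfl

instance [Finite α] : Finite (Orbits f) := Quot.finite _

/-- The orbits of `g` are those of `f` and one more. -/
theorem card_eq_add_one [Finite α] (R : β → Option (Orbits f)) (hR : ∀ y, R (g y) = R y)
    (m : α → Orbits g) (hm : ∀ x, m (f x) = m x) (z : Orbits g)
    (h₁ : ∀ x, lift R hR (m x) = some (mk f x)) (h₂ : lift R hR z = none)
    (h₃ : ∀ y, (R y).elim z (lift m hm) = mk g y) :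
    Nat.card (Orbits g) = Nat.card (Orbits f) + 1 := by
  rw [← Finite.card_option]
  refine Nat.card_congr
    { toFun := lift R hR
      invFun := fun o => o.elim z (lift m hm)
      left_inv := fun q => ?_
      right_inv := fun o => ?_ }
  · obtain ⟨y, rfl⟩ := q.exists_mk
    exact h₃ y
  · rcases o with _ | q
    · exact h₂
    · obtain ⟨x, rfl⟩ := q.exists_mk
      exact h₁ x

/-- Orbits of two maps correspond. -/
theorem card_eq (R : β → Orbits f) (hR : ∀ y, R (g y) = R y)
    (m : α → Orbits g) (hm : ∀ x, m (f x) = m x)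
    (h₁ : ∀ x, lift R hR (m x) = mk f x)
    (h₂ : ∀ y, lift m hm (R y) = mk g y) :
    Nat.card (Orbits g) = Nat.card (Orbits f) := by
  refine Nat.card_congr
    { toFun := lift R hR
      invFun := lift m hm
      left_inv := fun q => ?_
      right_inv := fun q => ?_ }
  · obtain ⟨y, rfl⟩ := q.exists_mk
    exact h₂ y
  · obtain ⟨x, rfl⟩ := q.exists_mk
    exact h₁ x

end Orbits

theorem Orbits.mk_eq_of_sameCycle [Finite α] {f : Equiv.Perm α} {x y : α} (h : f.SameCycle x y) :
    Orbits.mk f x = Orbits.mk f y := by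
  obtain ⟨n, rfl⟩ := h.exists_nat_pow_eq
  induction n with
  | zero => rfl
  | succ n ih =>
    rw [ih ⟨n, rfl⟩, pow_succ', Equiv.Perm.mul_apply]
    exact (Orbits.mk_apply f _).symm

/-- If `a` and `b` are on the same cycle of `f`, precomposition with the transposition of `a` and `b`
separates them. -/
theorem exists_separating [Finite α] [DecidableEq α] (f : Equiv.Perm α) {a b : α} (hab : a ≠ b)
    (h : f.SameCycle a b) :
    ∃ S : Set α, b ∈ S ∧ a ∉ S ∧ ∀ x, f (Equiv.swap a b x) ∈ S ↔ x ∈ S := by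
  classical
  have hex : ∃ k : ℕ, (f ^ k) a = b := h.exists_nat_pow_eq
  have hk := Nat.find_spec hex
  have hmin : ∀ m, m < Nat.find hex → (f ^ m) a ≠ b := fun m hm => Nat.find_min hex hm
  generalize Nat.find hex = k at hk hmin
  have hk0 : k ≠ 0 := by rintro rfl; exact hab hk
  -- A return to `a` after `j` steps could be left out, and `b` would be reached in `k - j` steps,
  -- against the minimality of `k`.
  have hret : ∀ j, 0 < j → j ≤ k → (f ^ j) a ≠ a := by
    intro j hj hjk hja
    refine hmin (k - j) (by omega) ?_
    rw [← hk]
    conv_rhs => rw [show k = (k - j) + j by omega, pow_add, Equiv.Perm.mul_apply, hja]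
  -- The segment of the cycle from `f a` to `b`. The transposition makes `f a` the successor of `b`,
  -- so the segment closes up.
  let S : Set α := {x | ∃ j, 0 < j ∧ j ≤ k ∧ (f ^ j) a = x}
  have hmaps : ∀ x, x ∈ S → f (Equiv.swap a b x) ∈ S := by
    rintro x ⟨j, hj, hjk, rfl⟩
    rcases hjk.eq_or_lt with rfl | hlt
    · rw [hk, Equiv.swap_apply_right]
      exact ⟨1, one_pos, hj, by simp⟩
    · rw [Equiv.swap_apply_of_ne_of_ne (hret j hj hjk) (hmin j hlt)]
      exact ⟨j + 1, by omega, by omega, by rw [pow_succ', Equiv.Perm.mul_apply]⟩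
  refine ⟨S, ⟨k, by omega, le_rfl, hk⟩, ?_, fun x => ⟨fun hx => ?_, hmaps x⟩⟩
  · rintro ⟨j, hj, hjk, hja⟩
    exact hret j hj hjk hja
  -- An injective map of a finite set into itself is onto, which gives the converse implication.
  · have himg : ((Equiv.swap a b).trans f) '' S = S := by
      refine Set.eq_of_subset_of_ncard_le ?_ ?_ S.toFinite
      · rintro _ ⟨y, hy, rfl⟩
        exact hmaps y hy
      · rw [Set.ncard_image_of_injective _ (Equiv.injective _)]
    rw [← himg] at hx
    obtain ⟨y, hy, hyx⟩ := hx
    rwa [← ((Equiv.swap a b).trans f).injective hyx]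

/-- Precomposition with a transposition of two elements of a cycle splits this cycle into two. -/
theorem card_orbits_comp_swap [Finite α] [DecidableEq α] (f : Equiv.Perm α) {a b : α} (hab : a ≠ b)
    (h : f.SameCycle a b) :
    Nat.card (Orbits fun x => f (Equiv.swap a b x)) = Nat.card (Orbits f) + 1 := by
  classical
  obtain ⟨S, hb, ha, hS⟩ := exists_separating f hab h
  generalize hg : (fun x => f (Equiv.swap a b x)) = g
  replace hg : ∀ x, f (Equiv.swap a b x) = g x := congrFun hg
  simp only [hg] at hS
  have hne : Orbits.mk g a ≠ Orbits.mk g b := by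
    intro heq
    have := congrArg (Orbits.lift (fun x => x ∈ S) fun x => propext (hS x)) heq
    simp [ha, hb] at this
  have hga : g a = f b := by simp [← hg]
  have hgb : g b = f a := by simp [← hg]
  have hgx : ∀ x, x ≠ a → x ≠ b → g x = f x := fun x h1 h2 => by
    rw [← hg, Equiv.swap_apply_of_ne_of_ne h1 h2]
  have hfa : Orbits.mk g (f a) = Orbits.mk g b := by rw [← hgb, Orbits.mk_apply]
  have hfb : Orbits.mk g (f b) = Orbits.mk g a := by rw [← hga, Orbits.mk_apply]
  have hab' : Orbits.mk f a = Orbits.mk f b := Orbits.mk_eq_of_sameCycle h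
  have hfg : ∀ x, Orbits.mk f (g x) = Orbits.mk f x := by
    intro x
    by_cases h1 : x = a
    · rw [h1, hga, Orbits.mk_apply, hab']
    by_cases h2 : x = b
    · rw [h2, hgb, Orbits.mk_apply, hab']
    rw [hgx x h1 h2, Orbits.mk_apply]
  -- The `g`-orbit of `b` is the additional one; the `f`-orbit that contains both `a` and `b`
  -- corresponds to the `g`-orbit of `a`.
  refine Orbits.card_eq_add_one
    (fun x => if Orbits.mk g x = Orbits.mk g b then none else some (Orbits.mk f x))
    (fun x => by simp only [Orbits.mk_apply, hfg])
    (fun x => if Orbits.mk g x = Orbits.mk g b then Orbits.mk g a else Orbits.mk g x)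
    (fun x => ?_) (Orbits.mk g b) (fun x => ?_) (by simp) (fun y => ?_)
  · by_cases h1 : x = a
    · simp [h1, hfa, hne]
    by_cases h2 : x = b
    · simp [h2, hfb]
    rw [← hgx x h1 h2, Orbits.mk_apply]
  · by_cases hx : Orbits.mk g x = Orbits.mk g b
    · have hx' := congrArg (Orbits.lift (Orbits.mk f) hfg) hx
      simp only [Orbits.lift_mk] at hx'
      simp [hx, hne, hab', hx']
    · simp [hx]
  · by_cases hy : Orbits.mk g y = Orbits.mk g b
    · simp [hy]
    · simp [hy]

end Orbits

/-! ### Passages and the boundary walk as a permutation -/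

section Passages

variable {C : Type}

@[simp] theorem other_other (y : C × Bool) : other (other y) = y := by simp [other]

theorem other_ne (y : C × Bool) : other y ≠ y := by
  intro h
  simpa [other] using congrArg Prod.snd h

theorem crossedLeftward_other (sign : C → ℤˣ) (y : C × Bool) :
    CrossedLeftward sign (other y) ↔ ¬ CrossedLeftward sign y := by
  obtain ⟨c, b⟩ := y
  rcases Int.units_eq_one_or (sign c) with h | h <;> cases b <;>
    simp [CrossedLeftward, other, h]

end Passages

namespace GaussCode

variable (D : GaussCode)

/-- Walk along the boundary of a face backward. -/
def facePrev : D.Edge × Bool → D.Edge × Bool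
  | (x, true) =>
      if CrossedLeftward D.sign (other x) then (D.next.symm (other x), true) else (other x, false)
  | (x, false) =>
      let y := other (D.next x)
      if CrossedLeftward D.sign y then (y, false) else (D.next.symm y, true)

variable {D}

theorem faceStep_true_of_pos {x : D.Edge} (h : CrossedLeftward D.sign (D.next x)) :
    D.faceStep (x, true) = (other (D.next x), true) := if_pos h

theorem faceStep_true_of_neg {x : D.Edge} (h : ¬ CrossedLeftward D.sign (D.next x)) :
    D.faceStep (x, true) = (D.next.symm (other (D.next x)), false) := if_neg h

theorem faceStep_false_of_pos {x : D.Edge} (h : CrossedLeftward D.sign x) :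
    D.faceStep (x, false) = (D.next.symm (other x), false) := if_pos h

theorem faceStep_false_of_neg {x : D.Edge} (h : ¬ CrossedLeftward D.sign x) :
    D.faceStep (x, false) = (other x, true) := if_neg h

theorem facePrev_true_of_pos {x : D.Edge} (h : CrossedLeftward D.sign (other x)) :
    D.facePrev (x, true) = (D.next.symm (other x), true) := if_pos h

theorem facePrev_true_of_neg {x : D.Edge} (h : ¬ CrossedLeftward D.sign (other x)) :
    D.facePrev (x, true) = (other x, false) := if_neg h

theorem facePrev_false_of_pos {x : D.Edge} (h : CrossedLeftward D.sign (other (D.next x))) :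
    D.facePrev (x, false) = (other (D.next x), false) := if_pos h

theorem facePrev_false_of_neg {x : D.Edge} (h : ¬ CrossedLeftward D.sign (other (D.next x))) :
    D.facePrev (x, false) = (D.next.symm (other (D.next x)), true) := if_neg h

variable (D)

/-- The boundary walk as a permutation. -/
def facePerm : Equiv.Perm (D.Edge × Bool) where
  toFun := D.faceStep
  invFun := D.facePrev
  left_inv := by
    rintro ⟨x, _ | _⟩
    · by_cases h : CrossedLeftward D.sign x
      · rw [faceStep_false_of_pos h, facePrev_false_of_pos] <;> simpa using h
      · rw [faceStep_false_of_neg h, facePrev_true_of_neg] <;> simp [h]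
    · by_cases h : CrossedLeftward D.sign (D.next x)
      · rw [faceStep_true_of_pos h, facePrev_true_of_pos] <;> simpa using h
      · rw [faceStep_true_of_neg h, facePrev_false_of_neg] <;> simp [h]
  right_inv := by
    rintro ⟨x, _ | _⟩
    · by_cases h : CrossedLeftward D.sign (other (D.next x))
      · rw [facePrev_false_of_pos h, faceStep_false_of_pos h]; simp
      · rw [facePrev_false_of_neg h, faceStep_true_of_neg] <;> simp [h]
    · by_cases h : CrossedLeftward D.sign (other x)
      · rw [facePrev_true_of_pos h, faceStep_true_of_pos] <;> simpa using h
      · rw [facePrev_true_of_neg h, faceStep_false_of_neg h]; simp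

@[simp] theorem facePerm_apply (z : D.Edge × Bool) : D.facePerm z = D.faceStep z := rfl

/-- On one of its sides, an edge is followed by another edge along the boundary of the face. -/
theorem exists_faceStep_ne (e : D.Edge) : ∃ t, (D.faceStep (e, t)).1 ≠ e := by
  by_contra! hall
  have h1 := hall true
  have h2 := hall false
  -- If `e` follows itself on its left, it is a loop that starts and ends at the same crossing. On
  -- its right the walk then turns into the other strand's outgoing edge, which is not `e`.
  by_cases hl : CrossedLeftward D.sign (D.next e)
  · rw [faceStep_true_of_pos hl] at h1
    have hne : ¬ CrossedLeftward D.sign e := by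
      have := (crossedLeftward_other D.sign (D.next e)).not.2 (not_not.2 hl)
      rwa [show other (D.next e) = e from h1] at this
    rw [faceStep_false_of_neg hne] at h2
    exact other_ne e h2
  · rw [faceStep_true_of_neg hl] at h1
    exact other_ne _ ((Equiv.symm_apply_eq _).1 h1)

end GaussCode

namespace GaussCode

/-! ### Pushing one edge over another one

The edge `p` is pushed over the edge `q`, across a face that is on the left of `(p, s)` and of
`(q, t)`. The new crossings are `inr false` and `inr true`, in the order in which `p` passes over
them. The edge `q` passes first under `inr (s == t)`. -/

section Push

variable (D : GaussCode) (p q : D.Edge) (s t : Bool)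

/-- The last piece of an old edge. -/
def pushLast (x : D.Edge) : (D.Crossing ⊕ Bool) × Bool :=
  if x = p then (.inr true, true) else if x = q then (.inr (!(s == t)), false) else (.inl x.1, x.2)

/-- The passage after a given passage of the new diagram. -/
def pushNextFun : (D.Crossing ⊕ Bool) × Bool → (D.Crossing ⊕ Bool) × Bool
  | (.inl c, b) =>
      if (c, b) = p then (.inr false, true)
      else if (c, b) = q then (.inr (s == t), false) else (.inl (D.next (c, b)).1, (D.next (c, b)).2)
  | (.inr i, true) => if i then (.inl (D.next p).1, (D.next p).2) else (.inr true, true)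
  | (.inr i, false) =>
      if i = (s == t) then (.inr (!(s == t)), false) else (.inl (D.next q).1, (D.next q).2)

/-- The passage before a given passage of the new diagram. -/
def pushPrevFun : (D.Crossing ⊕ Bool) × Bool → (D.Crossing ⊕ Bool) × Bool
  | (.inl c, b) => D.pushLast p q s t (D.next.symm (c, b))
  | (.inr i, true) => if i then (.inr false, true) else (.inl p.1, p.2)
  | (.inr i, false) => if i = (s == t) then (.inl q.1, q.2) else (.inr (s == t), false)

variable {p q}

/-- The code that arises when `p` is pushed over `q`. -/
def push (hpq : p ≠ q) : GaussCode where
  Crossing := D.Crossing ⊕ Bool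
  sign := Sum.elim D.sign fun i => if i = t then -1 else 1
  next :=
    { toFun := D.pushNextFun p q s t
      invFun := D.pushPrevFun p q s t
      left_inv := by
        rintro ⟨c | i, b⟩
        · by_cases h1 : (c, b) = p
          · subst h1
            simp [pushNextFun, pushPrevFun]
          by_cases h2 : (c, b) = q
          · subst h2
            simp [pushNextFun, pushPrevFun, h1]
          simp [pushNextFun, pushPrevFun, pushLast, h1, h2]
        · cases b <;> cases i <;> cases s <;> cases t <;>
            simp [pushNextFun, pushPrevFun, pushLast, hpq.symm]
      right_inv := by
        rintro ⟨c | i, b⟩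
        · by_cases h1 : D.next.symm (c, b) = p
          · subst h1
            simp [pushNextFun, pushPrevFun, pushLast]
          by_cases h2 : D.next.symm (c, b) = q
          · subst h2
            simp [pushNextFun, pushPrevFun, pushLast, hpq.symm]
          simp [pushNextFun, pushPrevFun, pushLast, h1, h2]
        · cases b <;> cases i <;> cases s <;> cases t <;>
            simp [pushNextFun, pushPrevFun, hpq.symm] }

variable {D} {s t : Bool} {hpq : p ≠ q}

/-- An old passage, considered as a passage of the new diagram. -/
def old (x : D.Edge) : (D.push s t hpq).Edge := (.inl x.1, x.2)

/-- The passages at the new crossings. -/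
def new (i b : Bool) : (D.push s t hpq).Edge := (.inr i, b)

/-- The last piece of an old edge. -/
def lastPiece (x : D.Edge) : (D.push s t hpq).Edge := D.pushLast p q s t x

theorem old_injective : Function.Injective (old : D.Edge → (D.push s t hpq).Edge) := by
  rintro ⟨c, b⟩ ⟨c', b'⟩ h
  obtain ⟨h1, h2⟩ := Prod.mk.inj h
  exact Prod.ext (Sum.inl_injective h1) h2

@[simp] theorem other_old (x : D.Edge) :
    other (old x : (D.push s t hpq).Edge) = old (other x) := rfl

@[simp] theorem other_new (i b : Bool) :
    other (new i b : (D.push s t hpq).Edge) = new i !b := rfl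

theorem passage_cases (y : (D.push s t hpq).Edge) :
    (∃ x, y = old x) ∨ ∃ i b, y = new i b := by
  obtain ⟨c | i, b⟩ := y
  · exact .inl ⟨(c, b), rfl⟩
  · exact .inr ⟨i, b, rfl⟩

theorem next_old_over : (D.push s t hpq).next (old p) = new false true :=
  if_pos rfl

theorem next_old_under : (D.push s t hpq).next (old q) = new (s == t) false :=
  (if_neg hpq.symm).trans (if_pos rfl)

theorem next_old {x : D.Edge} (hp : x ≠ p) (hq : x ≠ q) :
    (D.push s t hpq).next (old x) = old (D.next x) :=
  (if_neg hp).trans (if_neg hq)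

theorem next_new_over (i : Bool) :
    (D.push s t hpq).next (new i true) = if i then old (D.next p) else new true true := rfl

theorem next_new_under (i : Bool) : (D.push s t hpq).next (new i false) =
    if i = (s == t) then new (!(s == t)) false else old (D.next q) := rfl

theorem symm_old (x : D.Edge) :
    (D.push s t hpq).next.symm (old x) = lastPiece (D.next.symm x) := rfl

theorem symm_new_over (i : Bool) :
    (D.push s t hpq).next.symm (new i true) = if i then new false true else old p := rfl

theorem symm_new_under (i : Bool) : (D.push s t hpq).next.symm (new i false) =
    if i = (s == t) then old q else new (s == t) false := rfl

theorem lastPiece_over : (lastPiece p : (D.push s t hpq).Edge) = new true true := if_pos rfl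

theorem lastPiece_under : (lastPiece q : (D.push s t hpq).Edge) = new (!(s == t)) false :=
  (if_neg hpq.symm).trans (if_pos rfl)

theorem lastPiece_of_ne {x : D.Edge} (hp : x ≠ p) (hq : x ≠ q) :
    (lastPiece x : (D.push s t hpq).Edge) = old x :=
  (if_neg hp).trans (if_neg hq)

theorem next_lastPiece (x : D.Edge) :
    (D.push s t hpq).next (lastPiece x) = old (D.next x) := by
  have := symm_old (s := s) (t := t) (hpq := hpq) (D.next x)
  rw [Equiv.symm_apply_apply] at this
  exact ((Equiv.symm_apply_eq _).1 this).symm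

/-! The boundary walk of the new diagram -/

/-- The piece of an old edge with which a walk along this edge begins. -/
def firstDart : D.Edge × Bool → (D.push s t hpq).Edge × Bool
  | (x, true) => (old x, true)
  | (x, false) => (lastPiece x, false)

/-- The piece of an old edge with which a walk along this edge ends. -/
def lastDart : D.Edge × Bool → (D.push s t hpq).Edge × Bool
  | (x, true) => (lastPiece x, true)
  | (x, false) => (old x, false)

theorem crossedLeftward_new (i b : Bool) :
    CrossedLeftward (D.push s t hpq).sign (new i b) ↔ b = (i != t) := by
  cases i <;> cases b <;> cases t <;> simp [CrossedLeftward, push, new]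

/-- An old edge still ends at its old crossing, where the turn is unchanged. What remains is to
follow the walks from the first to the last piece of `p` and `q`. -/
theorem faceStep_lastDart (z : D.Edge × Bool) :
    (D.push s t hpq).faceStep (lastDart z) = firstDart (D.faceStep z) := by
  obtain ⟨x, _ | _⟩ := z
  · by_cases h : CrossedLeftward D.sign x
    · rw [faceStep_false_of_pos h, lastDart, faceStep_false_of_pos, other_old, symm_old] <;>
        first | exact h | rfl
    · rw [faceStep_false_of_neg h, lastDart, faceStep_false_of_neg, other_old] <;>
        first | exact h | rfl
  · by_cases h : CrossedLeftward D.sign (D.next x)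
    · rw [faceStep_true_of_pos h, lastDart, faceStep_true_of_pos, next_lastPiece, other_old]
      · rfl
      · rwa [next_lastPiece]
    · rw [faceStep_true_of_neg h, lastDart, faceStep_true_of_neg, next_lastPiece, other_old, symm_old]
      · rfl
      · rwa [next_lastPiece]

theorem faceStep_new_false (i b : Bool) : (D.push s t hpq).faceStep (new i b, false) =
    if b = (i != t) then ((D.push s t hpq).next.symm (new i !b), false) else (new i !b, true) :=
  if_congr (crossedLeftward_new i b) rfl rfl

theorem faceStep_true_of_next {x : (D.push s t hpq).Edge} {i b : Bool}
    (h : (D.push s t hpq).next x = new i b) :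
    (D.push s t hpq).faceStep (x, true) =
      if b = (i != t) then (new i !b, true) else ((D.push s t hpq).next.symm (new i !b), false) := by
  refine Eq.trans (congrArg (fun y => if CrossedLeftward (D.push s t hpq).sign y then
    (other y, true) else ((D.push s t hpq).next.symm (other y), false)) h) ?_
  exact if_congr (crossedLeftward_new i b) rfl rfl

/-- On the common face, a walk along `p` meets `q` at a new crossing, turns left there and goes on
as if it had come along `q`. Together with `faceStep_firstDart_under`, this is the interchange of
successors in `switchedStep`. -/
theorem faceStep_firstDart_over :
    (D.push s t hpq).faceStep (firstDart (p, s)) = lastDart (q, t) := by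
  cases s <;> cases t <;>
    simp [firstDart, lastDart, lastPiece_over, lastPiece_under, faceStep_new_false,
      faceStep_true_of_next next_old_over, symm_new_under]

theorem faceStep_firstDart_under :
    (D.push s t hpq).faceStep (firstDart (q, t)) = lastDart (p, s) := by
  cases s <;> cases t <;>
    simp [firstDart, lastDart, lastPiece_over, lastPiece_under, faceStep_new_false,
      faceStep_true_of_next next_old_under, symm_new_over]

/-- The middle piece of `p`. -/
def midOver : (D.push s t hpq).Edge := new false true

/-- The middle piece of `q`. -/
def midUnder : (D.push s t hpq).Edge := new (s == t) false

theorem next_midOver : (D.push s t hpq).next midOver = new true true := rfl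

theorem next_midUnder : (D.push s t hpq).next midUnder = new (!(s == t)) false := if_pos rfl

/-- On the far side of `q`, a walk along `q` only makes a detour around the middle piece of `p`;
likewise for the far side of `p` and the middle piece of `q` below. -/
theorem faceStep_midOver :
    (D.push s t hpq).faceStep (midOver, s) = lastDart (q, !t) := by
  cases s <;> cases t <;>
    simp [lastDart, lastPiece_under, faceStep_true_of_next next_midOver, symm_new_under] <;>
    simp [midOver, faceStep_new_false, symm_new_under]

theorem faceStep_firstDart_under_not :
    (D.push s t hpq).faceStep (firstDart (q, !t)) = (midOver, s) := by
  cases s <;> cases t <;>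
    simp [firstDart, lastPiece_under, midOver, faceStep_new_false,
      faceStep_true_of_next next_old_under, symm_new_over]

theorem faceStep_midUnder :
    (D.push s t hpq).faceStep (midUnder, t) = lastDart (p, !s) := by
  cases s <;> cases t <;>
    simp [lastDart, lastPiece_over, faceStep_true_of_next next_midUnder, symm_new_over] <;>
    simp [midUnder, faceStep_new_false, symm_new_over]

theorem faceStep_firstDart_over_not :
    (D.push s t hpq).faceStep (firstDart (p, !s)) = (midUnder, t) := by
  cases s <;> cases t <;>
    simp [firstDart, lastPiece_over, midUnder, faceStep_new_false,
      faceStep_true_of_next next_old_over, symm_new_under]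

/-- The inner sides of the two middle pieces follow each other: they bound the bigon. -/
theorem faceStep_midOver_not :
    (D.push s t hpq).faceStep (midOver, !s) = (midUnder, !t) := by
  cases s <;> cases t <;>
    simp [faceStep_true_of_next next_midOver, symm_new_under] <;>
    simp [midOver, midUnder, faceStep_new_false, symm_new_under]

theorem faceStep_midUnder_not :
    (D.push s t hpq).faceStep (midUnder, !t) = (midOver, !s) := by
  cases s <;> cases t <;>
    simp [faceStep_true_of_next next_midUnder, symm_new_over] <;>
    simp [midOver, midUnder, faceStep_new_false, symm_new_over]

theorem dart_cases (y : (D.push s t hpq).Edge × Bool) :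
    (∃ z, y = firstDart z) ∨ (∃ z, y = lastDart z) ∨ (∃ b, y = (midOver, b)) ∨
      ∃ b, y = (midUnder, b) := by
  obtain ⟨x, b⟩ := y
  rcases passage_cases x with ⟨x, rfl⟩ | ⟨i, c, rfl⟩
  · cases b
    · exact .inr (.inl ⟨(x, false), rfl⟩)
    · exact .inl ⟨(x, true), rfl⟩
  · cases c
    · by_cases hi : i = (s == t)
      · exact .inr (.inr (.inr ⟨b, by rw [hi, midUnder]⟩))
      · have hl : (lastPiece q : (D.push s t hpq).Edge) = new i false := by
          rw [lastPiece_under, Bool.eq_not_of_ne hi]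
        cases b
        · exact .inl ⟨(q, false), by rw [firstDart, hl]⟩
        · exact .inr (.inl ⟨(q, true), by rw [lastDart, hl]⟩)
    · cases i
      · exact .inr (.inr (.inl ⟨b, rfl⟩))
      · cases b
        · exact .inl ⟨(p, false), by rw [firstDart, lastPiece_over]⟩
        · exact .inr (.inl ⟨(p, true), by rw [lastDart, lastPiece_over]⟩)

theorem firstDart_eq_lastDart {z : D.Edge × Bool} (hp : z.1 ≠ p) (hq : z.1 ≠ q) :
    (firstDart z : (D.push s t hpq).Edge × Bool) = lastDart z := by
  obtain ⟨x, _ | _⟩ := z <;> simp [firstDart, lastDart, lastPiece_of_ne hp hq]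

/-! ### The number of faces after a push -/

section Count

variable (D p q s t)

/-- The boundary walk of the old diagram, with the successors of the darts `(p, s)` and `(q, t)`
interchanged. -/
def switchedStep (z : D.Edge × Bool) : D.Edge × Bool :=
  D.facePerm (Equiv.swap (p, s) (q, t) z)

/-- The orbit of the switched walk to which a dart of the new diagram belongs; `none` stands for
the bigon. -/
def pushOrbit : (D.Crossing ⊕ Bool) × Bool → Bool → Option (Orbits (D.switchedStep p q s t))
  | (.inl c, b), true => some (.mk _ ((c, b), true))
  | (.inl c, b), false => some (.mk _ (D.faceStep ((c, b), false)))
  | (.inr i, true), b =>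
      if i then if b then some (.mk _ (D.faceStep (p, true))) else some (.mk _ (p, false))
      else if b = s then some (.mk _ (q, !t)) else none
  | (.inr i, false), b =>
      if i = (s == t) then if b = t then some (.mk _ (p, !s)) else none
      else if b then some (.mk _ (D.faceStep (q, true))) else some (.mk _ (q, false))

end Count

/-- The orbit of the switched walk to which a dart of the new diagram belongs. -/
def dartOrbit (y : (D.push s t hpq).Edge × Bool) : Option (Orbits (D.switchedStep p q s t)) :=
  D.pushOrbit p q s t y.1 y.2

theorem switchedStep_of_ne {z : D.Edge × Bool} (hp : z ≠ (p, s)) (hq : z ≠ (q, t)) :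
    D.switchedStep p q s t z = D.faceStep z := by
  rw [switchedStep, Equiv.swap_apply_of_ne_of_ne hp hq, facePerm_apply]

theorem switchedStep_over : D.switchedStep p q s t (p, s) = D.faceStep (q, t) := by
  rw [switchedStep, Equiv.swap_apply_left, facePerm_apply]

theorem switchedStep_under : D.switchedStep p q s t (q, t) = D.faceStep (p, s) := by
  rw [switchedStep, Equiv.swap_apply_right, facePerm_apply]

theorem orbit_faceStep {z : D.Edge × Bool} (hp : z ≠ (p, s)) (hq : z ≠ (q, t)) :
    Orbits.mk (D.switchedStep p q s t) (D.faceStep z) = Orbits.mk _ z := by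
  rw [← switchedStep_of_ne hp hq, Orbits.mk_apply]

theorem dartOrbit_lastDart (z : D.Edge × Bool) :
    dartOrbit (lastDart z : (D.push s t hpq).Edge × Bool) = some (.mk _ (D.faceStep z)) := by
  obtain ⟨x, _ | _⟩ := z
  · rfl
  · by_cases hp : x = p
    · subst hp
      rw [lastDart, lastPiece_over]; rfl
    by_cases hq : x = q
    · subst hq
      rw [lastDart, lastPiece_under]
      exact if_neg (by simp)
    rw [orbit_faceStep, lastDart, lastPiece_of_ne hp hq]
    · rfl
    · exact fun h => hp (congrArg Prod.fst h)
    · exact fun h => hq (congrArg Prod.fst h)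

theorem dartOrbit_firstDart (z : D.Edge × Bool) :
    dartOrbit (firstDart z : (D.push s t hpq).Edge × Bool) = some (.mk _ z) := by
  obtain ⟨x, _ | _⟩ := z
  · by_cases hp : x = p
    · subst hp
      rw [firstDart, lastPiece_over]; rfl
    by_cases hq : x = q
    · subst hq
      rw [firstDart, lastPiece_under]
      exact if_neg (by simp)
    rw [firstDart_eq_lastDart hp hq, dartOrbit_lastDart, orbit_faceStep]
    · exact fun h => hp (congrArg Prod.fst h)
    · exact fun h => hq (congrArg Prod.fst h)
  · rfl

theorem dartOrbit_midOver (b : Bool) :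
    dartOrbit ((midOver, b) : (D.push s t hpq).Edge × Bool) =
      if b = s then some (.mk _ (q, !t)) else none := rfl

theorem dartOrbit_midUnder (b : Bool) :
    dartOrbit ((midUnder, b) : (D.push s t hpq).Edge × Bool) =
      if b = t then some (.mk _ (p, !s)) else none :=
  if_pos (c := (s == t) = (s == t)) rfl

theorem firstDart_cases (z : D.Edge × Bool) :
    z = (p, s) ∨ z = (q, t) ∨ z = (p, !s) ∨ z = (q, !t) ∨
      (firstDart z : (D.push s t hpq).Edge × Bool) = lastDart z ∧ z ≠ (p, s) ∧ z ≠ (q, t) := by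
  obtain ⟨x, b⟩ := z
  by_cases hp : x = p
  · subst hp
    by_cases hb : b = s
    · simp [hb]
    · simp [Bool.eq_not_of_ne hb]
  by_cases hq : x = q
  · subst hq
    by_cases hb : b = t
    · simp [hb]
    · simp [Bool.eq_not_of_ne hb]
  simp [hp, hq, firstDart_eq_lastDart (z := (x, b)) hp hq]

theorem dartOrbit_faceStep (y : (D.push s t hpq).Edge × Bool) :
    dartOrbit ((D.push s t hpq).faceStep y) = dartOrbit y := by
  have hlast : ∀ z, dartOrbit ((D.push s t hpq).faceStep (lastDart z)) =
      dartOrbit (lastDart z : (D.push s t hpq).Edge × Bool) := by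
    intro z
    rw [faceStep_lastDart, dartOrbit_firstDart, dartOrbit_lastDart]
  rcases dart_cases y with ⟨z, rfl⟩ | ⟨z, rfl⟩ | ⟨b, rfl⟩ | ⟨b, rfl⟩
  · rcases firstDart_cases (s := s) (t := t) (hpq := hpq) z with rfl | rfl | rfl | rfl | ⟨h, -, -⟩
    · rw [faceStep_firstDart_over, dartOrbit_lastDart, dartOrbit_firstDart,
        ← switchedStep_over (p := p) (s := s), Orbits.mk_apply]
    · rw [faceStep_firstDart_under, dartOrbit_lastDart, dartOrbit_firstDart,
        ← switchedStep_under (q := q) (t := t), Orbits.mk_apply]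
    · rw [faceStep_firstDart_over_not, dartOrbit_midUnder, dartOrbit_firstDart, if_pos rfl]
    · rw [faceStep_firstDart_under_not, dartOrbit_midOver, dartOrbit_firstDart, if_pos rfl]
    · rw [h]; exact hlast z
  · exact hlast z
  · by_cases hb : b = s
    · subst hb
      rw [faceStep_midOver, dartOrbit_lastDart, dartOrbit_midOver, if_pos rfl, orbit_faceStep] <;>
        simp [hpq.symm]
    · rw [Bool.eq_not_of_ne hb, faceStep_midOver_not, dartOrbit_midUnder, dartOrbit_midOver]
      simp
  · by_cases hb : b = t
    · subst hb
      rw [faceStep_midUnder, dartOrbit_lastDart, dartOrbit_midUnder, if_pos rfl, orbit_faceStep] <;>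
        simp [hpq]
    · rw [Bool.eq_not_of_ne hb, faceStep_midUnder_not, dartOrbit_midUnder, dartOrbit_midOver]
      simp

theorem orbit_firstDart_switchedStep (z : D.Edge × Bool) :
    Orbits.mk (D.push s t hpq).faceStep (firstDart (D.switchedStep p q s t z)) =
      Orbits.mk _ (firstDart z) := by
  rcases firstDart_cases (s := s) (t := t) (hpq := hpq) z with rfl | rfl | rfl | rfl | ⟨h, hp, hq⟩
  · rw [switchedStep_over, ← faceStep_lastDart, ← faceStep_firstDart_over]
    simp only [Orbits.mk_apply]
  · rw [switchedStep_under, ← faceStep_lastDart, ← faceStep_firstDart_under]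
    simp only [Orbits.mk_apply]
  · rw [switchedStep_of_ne (by simp) (by simp [hpq]), ← faceStep_lastDart, ← faceStep_midUnder,
      ← faceStep_firstDart_over_not]
    simp only [Orbits.mk_apply]
  · rw [switchedStep_of_ne (by simp [hpq.symm]) (by simp), ← faceStep_lastDart, ← faceStep_midOver,
      ← faceStep_firstDart_under_not]
    simp only [Orbits.mk_apply]
  · rw [switchedStep_of_ne hp hq, ← faceStep_lastDart, Orbits.mk_apply, h]

/-- One new face is the bigon. The other arises because the finger pushed across the common face
cuts it in two. -/
theorem card_face_push (h : D.facePerm.SameCycle (p, s) (q, t)) :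
    Nat.card (D.push s t hpq).Face = Nat.card D.Face + 2 := by
  have h1 : Nat.card (Orbits (D.push s t hpq).faceStep) =
      Nat.card (Orbits (D.switchedStep p q s t)) + 1 := by
    refine Orbits.card_eq_add_one dartOrbit dartOrbit_faceStep
      (fun z => Orbits.mk _ (firstDart z)) orbit_firstDart_switchedStep
      (Orbits.mk _ (midOver, !s)) (fun z => dartOrbit_firstDart z) ?_ fun y => ?_
    · rw [Orbits.lift_mk, dartOrbit_midOver]; simp
    · rcases dart_cases y with ⟨z, rfl⟩ | ⟨z, rfl⟩ | ⟨b, rfl⟩ | ⟨b, rfl⟩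
      · rw [dartOrbit_firstDart]; rfl
      · rw [dartOrbit_lastDart, Option.elim_some, Orbits.lift_mk, ← faceStep_lastDart,
          Orbits.mk_apply]
      · rw [dartOrbit_midOver]
        by_cases hb : b = s
        · subst hb
          rw [if_pos rfl, Option.elim_some, Orbits.lift_mk, ← faceStep_firstDart_under_not,
            Orbits.mk_apply]
        · rw [if_neg hb, Bool.eq_not_of_ne hb]; rfl
      · rw [dartOrbit_midUnder]
        by_cases hb : b = t
        · subst hb
          rw [if_pos rfl, Option.elim_some, Orbits.lift_mk, ← faceStep_firstDart_over_not,
            Orbits.mk_apply]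
        · rw [if_neg hb, Bool.eq_not_of_ne hb, ← Orbits.mk_apply _ (midUnder, _),
            faceStep_midUnder_not]
          rfl
  have h2 : Nat.card (Orbits (D.switchedStep p q s t)) = Nat.card (Orbits D.faceStep) + 1 :=
    card_orbits_comp_swap D.facePerm (fun heq => hpq (congrArg Prod.fst heq)) h
  exact h1.trans (by rw [h2]; rfl)

theorem sameCycle_old {x y : D.Edge} (h : D.next.SameCycle x y) :
    (D.push s t hpq).next.SameCycle (old x) (old y) := by
  obtain ⟨n, rfl⟩ := h.exists_nat_pow_eq
  clear h
  induction n with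
  | zero => exact Equiv.Perm.SameCycle.refl _ _
  | succ n ih =>
    refine ih.trans ?_
    rw [pow_succ', Equiv.Perm.mul_apply]
    generalize (D.next ^ n) x = z
    by_cases hp : z = p
    · subst hp
      -- Two new passages have been inserted before the next old one.
      refine ⟨3, ?_⟩
      change (D.push s t hpq).next ((D.push s t hpq).next ((D.push s t hpq).next (old z))) = _
      rw [next_old_over, next_new_over, if_neg (by simp), next_new_over, if_pos rfl]
    by_cases hq : z = q
    · subst hq
      refine ⟨3, ?_⟩
      change (D.push s t hpq).next ((D.push s t hpq).next ((D.push s t hpq).next (old z))) = _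
      rw [next_old_under, next_new_under, if_pos rfl, next_new_under, if_neg (by simp)]
    exact ⟨1, next_old hp hq⟩

theorem exists_sameCycle_old (y : (D.push s t hpq).Edge) :
    ∃ x, (D.push s t hpq).next.SameCycle (old x) y := by
  rcases passage_cases y with ⟨x, rfl⟩ | ⟨i, b, rfl⟩
  · exact ⟨x, Equiv.Perm.SameCycle.refl _ _⟩
  have step : ∀ y, (D.push s t hpq).next.SameCycle y ((D.push s t hpq).next y) := fun y => ⟨1, rfl⟩
  cases b
  · refine ⟨q, ?_⟩
    have h1 : (D.push s t hpq).next.SameCycle (old q) midUnder := by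
      have := step (old q)
      rwa [next_old_under] at this
    by_cases hi : i = (s == t)
    · rw [hi]; exact h1
    · rw [Bool.eq_not_of_ne hi]
      exact h1.trans (by rw [← next_midUnder]; exact step _)
  · refine ⟨p, ?_⟩
    have h1 : (D.push s t hpq).next.SameCycle (old p) midOver := by
      have := step (old p)
      rwa [next_old_over] at this
    cases i
    · exact h1
    · exact h1.trans (by rw [← next_midOver]; exact step _)

end Push
end GaussCode

/-! ### Planarity of the pushed diagram -/

namespace KnotDiagram

variable (D : KnotDiagram) {p q : D.Edge} (s t : Bool) (hpq : p ≠ q)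

/-- The diagram that arises when `p` is pushed over `q` across a common face. -/
def push (h : D.facePerm.SameCycle (p, s) (q, t)) : KnotDiagram where
  toGaussCode := D.toGaussCode.push s t hpq
  one_component x y := by
    obtain ⟨x', hx⟩ := GaussCode.exists_sameCycle_old x
    obtain ⟨y', hy⟩ := GaussCode.exists_sameCycle_old y
    exact hx.symm.trans ((GaussCode.sameCycle_old (D.one_component x' y')).trans hy)
  planar := by
    -- Two more crossings, two more faces and four more edges.
    rw [GaussCode.card_face_push h]
    have := D.planar
    change Fintype.card (D.Crossing ⊕ Bool) + _ = Fintype.card ((D.Crossing ⊕ Bool) × Bool) + 2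
    simp only [Fintype.card_sum, Fintype.card_prod, Fintype.card_bool] at this ⊢
    omega

end KnotDiagram

namespace GaussCode

theorem arcOf_next {D : GaussCode} {x : D.Edge} (h : (D.next x).2 = true) :
    D.arcOf (D.next x) = D.arcOf x :=
  (Quot.sound (r := fun x y : D.Edge => y = D.next x ∧ y.2 = true) ⟨rfl, h⟩).symm

/-- A property of edges that is preserved along over-passages depends on the arc only. -/
theorem arcOf_ne {D : GaussCode} (P : D.Edge → Prop)
    (hP : ∀ x, (D.next x).2 = true → (P (D.next x) ↔ P x)) {x y : D.Edge} (hx : P x) (hy : ¬ P y) :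
    D.arcOf x ≠ D.arcOf y := by
  intro h
  have := congrArg (Quot.lift P (by rintro x _ ⟨rfl, h⟩; exact propext (hP x h).symm)) h
  change P x = P y at this
  rw [this] at hx
  exact hy hx

end GaussCode

/-! ### Colors after a push, and the push as a Reidemeister move -/

namespace ColoredDiagram

open GaussCode

variable {X : Type*} [Quandle X] (K : ColoredDiagram X)

/-- The color of an edge. -/
def edgeColor (x : K.diagram.Edge) : X := K.color (K.diagram.arcOf x)

theorem edgeColor_next {x : K.diagram.Edge} (h : (K.diagram.next x).2 = true) :
    K.edgeColor (K.diagram.next x) = K.edgeColor x :=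
  congrArg K.color (arcOf_next h)

variable (p q : K.diagram.Edge) (s t : Bool)

/-- The colors of the edges after `p` has been pushed over `q`. -/
def pushColorFun : (K.diagram.Crossing ⊕ Bool) × Bool → X
  | (.inl c, b) => K.edgeColor (c, b)
  | (.inr i, b) =>
      if b then K.edgeColor p
      else if i = (s == t) then
        -- The crossing under which `q` passes first has index `s == t`, so it is negative exactly
        -- if `s` is true.
        if s then K.edgeColor p ◃⁻¹ K.edgeColor q else K.edgeColor p ◃ K.edgeColor q
      else K.edgeColor q

variable {p q} {s t} {hpq : p ≠ q}

/-- The colors of the edges after `p` has been pushed over `q`. -/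
def pushColor (x : (K.diagram.toGaussCode.push s t hpq).Edge) : X := K.pushColorFun p q s t x

theorem pushColor_old (x : K.diagram.Edge) :
    K.pushColor (old x : (K.diagram.toGaussCode.push s t hpq).Edge) = K.edgeColor x := rfl

theorem pushColor_new_over (i : Bool) :
    K.pushColor (new i true : (K.diagram.toGaussCode.push s t hpq).Edge) = K.edgeColor p := rfl

theorem pushColor_new_under (i : Bool) :
    K.pushColor (new i false : (K.diagram.toGaussCode.push s t hpq).Edge) =
      if i = (s == t) then
        if s then K.edgeColor p ◃⁻¹ K.edgeColor q else K.edgeColor p ◃ K.edgeColor q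
      else K.edgeColor q := rfl

/-- For `x = q` this provides two edges of equal color, the outer pieces of `q`, separated by
under-passages. -/
theorem pushColor_lastPiece (x : K.diagram.Edge) :
    K.pushColor (lastPiece x : (K.diagram.toGaussCode.push s t hpq).Edge) = K.edgeColor x := by
  by_cases hp : x = p
  · subst hp
    rw [lastPiece_over, pushColor_new_over]
  by_cases hq : x = q
  · subst hq
    rw [lastPiece_under, pushColor_new_under, if_neg (by simp)]
  rw [lastPiece_of_ne hp hq, pushColor_old]

/-- Needed for the colors of edges to descend to arcs. -/
theorem pushColor_next (x : (K.diagram.toGaussCode.push s t hpq).Edge)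
    (h : ((K.diagram.toGaussCode.push s t hpq).next x).2 = true) :
    K.pushColor ((K.diagram.toGaussCode.push s t hpq).next x) = K.pushColor x := by
  have hlast : ∀ x : K.diagram.Edge, (K.diagram.next x).2 = true →
      K.pushColor ((K.diagram.toGaussCode.push s t hpq).next (lastPiece x)) =
      K.pushColor (lastPiece x : (K.diagram.toGaussCode.push s t hpq).Edge) := by
    intro x h
    rw [next_lastPiece, pushColor_old, pushColor_lastPiece, edgeColor_next K h]
  rcases passage_cases x with ⟨x, rfl⟩ | ⟨i, b, rfl⟩
  · by_cases hp : x = p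
    · subst hp
      rw [next_old_over]; rfl
    by_cases hq : x = q
    · subst hq
      rw [next_old_under] at h
      cases h
    rw [next_old hp hq] at h
    have := hlast x h
    rwa [lastPiece_of_ne hp hq] at this
  · cases b
    · by_cases hi : i = (s == t)
      · rw [next_new_under, if_pos hi] at h
        cases h
      · have hl : lastPiece q = (new i false : (K.diagram.toGaussCode.push s t hpq).Edge) := by
          rw [lastPiece_under, Bool.eq_not_of_ne hi]
        rw [← hl] at h ⊢
        rw [next_lastPiece] at h
        exact hlast q h
    · cases i
      · rfl
      · have hl : lastPiece p = (new true true : (K.diagram.toGaussCode.push s t hpq).Edge) :=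
          lastPiece_over
        rw [← hl] at h ⊢
        rw [next_lastPiece] at h
        exact hlast p h

theorem pushColor_pos (c : (K.diagram.toGaussCode.push s t hpq).Crossing)
    (hc : (K.diagram.toGaussCode.push s t hpq).sign c = 1) :
    K.pushColor (c, false) = K.pushColor (c, true) ◃
      K.pushColor ((K.diagram.toGaussCode.push s t hpq).next.symm (c, false)) := by
  rcases c with c | i
  · have h : K.edgeColor (c, false) = K.edgeColor (c, true) ◃
        K.pushColor (lastPiece (K.diagram.next.symm (c, false)) :
          (K.diagram.toGaussCode.push s t hpq).Edge) := by
      rw [pushColor_lastPiece]; exact K.pos c hc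
    exact h
  · have hi : ¬ i = t := by
      rintro rfl
      revert hc
      simp [GaussCode.push]
    change K.pushColor (new i false) = K.pushColor (new i true) ◃
      K.pushColor ((K.diagram.toGaussCode.push s t hpq).next.symm (new i false))
    rw [symm_new_under, pushColor_new_under, pushColor_new_over]
    cases i <;> cases s <;> cases t <;> simp [pushColor_old, pushColor_new_under] at hi ⊢

theorem pushColor_neg (c : (K.diagram.toGaussCode.push s t hpq).Crossing)
    (hc : (K.diagram.toGaussCode.push s t hpq).sign c = -1) :
    K.pushColor ((K.diagram.toGaussCode.push s t hpq).next.symm (c, false)) =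
      K.pushColor (c, true) ◃ K.pushColor (c, false) := by
  rcases c with c | i
  · have h : K.pushColor (lastPiece (K.diagram.next.symm (c, false)) :
          (K.diagram.toGaussCode.push s t hpq).Edge) =
        K.edgeColor (c, true) ◃ K.edgeColor (c, false) := by
      rw [pushColor_lastPiece]; exact K.neg c hc
    exact h
  · have hi : i = t := by
      by_contra h
      revert hc
      simp [GaussCode.push, h]
    change K.pushColor ((K.diagram.toGaussCode.push s t hpq).next.symm (new i false)) =
      K.pushColor (new i true) ◃ K.pushColor (new i false)
    rw [symm_new_under, pushColor_new_under, pushColor_new_over]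
    cases i <;> cases s <;> cases t <;> simp [pushColor_old, pushColor_new_under] at hi ⊢

variable (s t hpq)

/-- The colored diagram that arises when `p` is pushed over `q` across a common face. -/
def push (h : K.diagram.facePerm.SameCycle (p, s) (q, t)) : ColoredDiagram X where
  diagram := K.diagram.push s t hpq h
  color := Quot.lift (K.pushColor (s := s) (t := t) (hpq := hpq))
    (by rintro x _ ⟨rfl, h⟩; exact (K.pushColor_next x h).symm)
  pos := K.pushColor_pos (s := s) (t := t) (hpq := hpq)
  neg := K.pushColor_neg (s := s) (t := t) (hpq := hpq)

variable {s t hpq} {h : K.diagram.facePerm.SameCycle (p, s) (q, t)}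

theorem push_isNontrivial (hK : K.IsNontrivial) : (K.push s t hpq h).IsNontrivial := by
  obtain ⟨⟨x⟩, ⟨y⟩, hxy⟩ := hK
  exact ⟨(K.diagram.toGaussCode.push s t hpq).arcOf (old x),
    (K.diagram.toGaussCode.push s t hpq).arcOf (old y), hxy⟩

/-- Pushing an edge over another one is a Reidemeister move of type II. -/
def pushCreation : R2Creation K.diagram (K.push s t hpq h).diagram where
  c₁ := .inr false
  c₂ := .inr true
  sign_ne := by
    change (if false = t then (-1 : ℤˣ) else 1) ≠ if true = t then (-1 : ℤˣ) else 1
    cases t <;> decide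
  over_consecutive := rfl
  under_consecutive := by
    change (K.diagram.toGaussCode.push s t hpq).next (new false false) = new true false ∨
      (K.diagram.toGaussCode.push s t hpq).next (new true false) = new false false
    simp only [next_new_under]
    cases s <;> cases t <;> simp
  incl := Sum.inl
  incl_injective := Sum.inl_injective
  range_incl c := by
    change (∃ y, Sum.inl y = c) ↔ _
    rcases c with c | i
    · exact ⟨fun _ => ⟨Sum.inl_ne_inr, Sum.inl_ne_inr⟩, fun _ => ⟨c, rfl⟩⟩
    · constructor
      · rintro ⟨y, hy⟩; cases hy
      · rintro ⟨h1, h2⟩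
        cases i
        · exact absurd rfl h1
        · exact absurd rfl h2
  sign_incl _ := rfl
  next_incl x := by
    change ∃ k : ℕ, (K.diagram.toGaussCode.push s t hpq).next^[k + 1] (old x) =
      old (K.diagram.next x) ∧ ∀ j < k,
        ((K.diagram.toGaussCode.push s t hpq).next^[j + 1] (old x)).1 = .inr false ∨
        ((K.diagram.toGaussCode.push s t hpq).next^[j + 1] (old x)).1 = .inr true
    have hnew : ∀ i b, (new i b : (K.diagram.toGaussCode.push s t hpq).Edge).1 = .inr false ∨
        (new i b : (K.diagram.toGaussCode.push s t hpq).Edge).1 = .inr true := by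
      rintro (_ | _) b
      · exact .inl rfl
      · exact .inr rfl
    by_cases hp : x = p
    · subst hp
      refine ⟨2, ?_, fun j hj => ?_⟩
      · simp only [Function.iterate_succ_apply, Function.iterate_zero_apply, next_old_over]
        rfl
      · interval_cases j <;>
          simp only [Function.iterate_succ_apply, Function.iterate_zero_apply, next_old_over]
        · exact hnew _ _
        · exact .inr rfl
    by_cases hq : x = q
    · subst hq
      have h2 : (K.diagram.toGaussCode.push s t hpq).next
          (new (s == t) false) = new (!(s == t)) false := next_midUnder
      refine ⟨2, ?_, fun j hj => ?_⟩
      · simp only [Function.iterate_succ_apply, Function.iterate_zero_apply, next_old_under, h2]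
        rw [next_new_under, if_neg (by simp)]
      · interval_cases j <;>
          simp only [Function.iterate_succ_apply, Function.iterate_zero_apply, next_old_under, h2]
        · exact hnew _ _
        · exact hnew _ _
    exact ⟨0, next_old hp hq, fun j hj => absurd hj (by simp)⟩

theorem coloredR2Move_push : ColoredR2Move K (K.push s t hpq h) :=
  .inl ⟨K.pushCreation, fun _ => rfl⟩

end ColoredDiagram

namespace GaussCode

/-! ### Cutting two edges at a common face -/

section Cut

variable (D : GaussCode) (e f : D.Edge) (s : Bool)

/-- The passages of the diagram with the edges `e` and `f` cut, in the order of the strands. -/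
def cutNextFun : (D.Crossing × Bool) ⊕ Bool → (D.Crossing × Bool) ⊕ Bool
  | .inl x => if x = e then .inr true else if x = f then .inr false else .inl (D.next x)
  | .inr i => if i then .inl (D.next f) else .inl (D.next e)

/-- The last piece of an edge of the diagram that is cut. -/
def cutLast (x : D.Edge) : (D.Crossing × Bool) ⊕ Bool :=
  if x = e then .inr false else if x = f then .inr true else .inl x

/-- The passages of the diagram with the edges `e` and `f` cut, in the opposite order. -/
def cutPrevFun : (D.Crossing × Bool) ⊕ Bool → (D.Crossing × Bool) ⊕ Bool
  | .inl x => D.cutLast e f (D.next.symm x)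
  | .inr i => if i then .inl e else .inl f

/-- The counterclockwise order of the ends of the strands, if the edge `e` runs along the common
face in the direction `s` and the edge `f` in the opposite direction. -/
def cutBoundary : Equiv.Perm (Bool × Bool) where
  -- For `s = true` the order is: initial end of `false`, terminal end of `true`, terminal end of
  -- `false`, initial end of `true`. For `s = false` it is reversed.
  toFun a := (!a.1, (a.1 == a.2) == s)
  invFun a := (!a.1, (a.1 == a.2) == !s)
  left_inv := by revert s; decide
  right_inv := by revert s; decide

variable {e f}

/-- The tangle that arises when `e` and `f` are cut. -/
def cut (hef : e ≠ f) : TangleCode where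
  Crossing := D.Crossing
  sign := D.sign
  next :=
    { toFun := D.cutNextFun e f
      invFun := D.cutPrevFun e f
      left_inv := by
        rintro (x | i)
        · by_cases h1 : x = e
          · simp [cutNextFun, cutPrevFun, h1]
          by_cases h2 : x = f
          · simp [cutNextFun, cutPrevFun, h2, hef.symm]
          simp [cutNextFun, cutPrevFun, cutLast, h1, h2]
        · cases i <;> simp [cutNextFun, cutPrevFun, cutLast, hef.symm]
      right_inv := by
        rintro (x | i)
        · by_cases h1 : D.next.symm x = e
          · subst h1
            simp [cutNextFun, cutPrevFun, cutLast]
          by_cases h2 : D.next.symm x = f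
          · subst h2
            simp [cutNextFun, cutPrevFun, cutLast, hef.symm]
          simp [cutNextFun, cutPrevFun, cutLast, h1, h2]
        · cases i <;> simp [cutNextFun, cutPrevFun, hef.symm] }
  boundaryNext := cutBoundary s

variable {D} {s} {hef : e ≠ f}

/-- A passage of the knot diagram, considered as a passage of the tangle. -/
def passage (x : D.Edge) : (D.cut s hef).Edge := .inl x

/-- The endpoints of the strands. -/
def endpoint (i : Bool) : (D.cut s hef).Edge := .inr i

/-- The last piece of an edge of the diagram that is cut. -/
def lastCutPiece (x : D.Edge) : (D.cut s hef).Edge := D.cutLast e f x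

theorem cut_edge_cases (y : (D.cut s hef).Edge) : (∃ x, y = passage x) ∨ ∃ i, y = endpoint i := by
  rcases y with x | i
  · exact .inl ⟨x, rfl⟩
  · exact .inr ⟨i, rfl⟩

theorem cut_next_start : (D.cut s hef).next (passage e) = endpoint true := if_pos rfl

theorem cut_next_end : (D.cut s hef).next (passage f) = endpoint false :=
  (if_neg hef.symm).trans (if_pos rfl)

theorem cut_next {x : D.Edge} (he : x ≠ e) (hf : x ≠ f) :
    (D.cut s hef).next (passage x) = passage (D.next x) :=
  (if_neg he).trans (if_neg hf)

theorem cut_next_endpoint (i : Bool) :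
    (D.cut s hef).next (endpoint i) = if i then passage (D.next f) else passage (D.next e) := rfl

theorem lastCutPiece_start : (lastCutPiece e : (D.cut s hef).Edge) = endpoint false := if_pos rfl

theorem lastCutPiece_end : (lastCutPiece f : (D.cut s hef).Edge) = endpoint true :=
  (if_neg hef.symm).trans (if_pos rfl)

theorem lastCutPiece_of_ne {x : D.Edge} (he : x ≠ e) (hf : x ≠ f) :
    (lastCutPiece x : (D.cut s hef).Edge) = passage x :=
  (if_neg he).trans (if_neg hf)

theorem cut_symm_passage (x : D.Edge) :
    (D.cut s hef).next.symm (passage x) = lastCutPiece (D.next.symm x) := rfl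

theorem cut_next_lastCutPiece (x : D.Edge) :
    (D.cut s hef).next (lastCutPiece x) = passage (D.next x) := by
  have := cut_symm_passage (s := s) (hef := hef) (D.next x)
  rw [Equiv.symm_apply_apply] at this
  exact ((Equiv.symm_apply_eq _).1 this).symm

/-! ### The two strands of the tangle -/

theorem exists_strand (h : ∀ x y, D.next.SameCycle x y) (y : (D.cut s hef).Edge) :
    ∃ i, (D.cut s hef).next.SameCycle (endpoint i) y := by
  rcases cut_edge_cases y with ⟨x, rfl⟩ | ⟨i, rfl⟩
  · obtain ⟨n, rfl⟩ := (h (D.next e) x).exists_nat_pow_eq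
    induction n with
    | zero => exact ⟨false, 1, rfl⟩
    | succ n ih =>
      obtain ⟨i, hi⟩ := ih
      rw [pow_succ', Equiv.Perm.mul_apply]
      generalize (D.next ^ n) (D.next e) = z at hi
      by_cases he : z = e
      · rw [he]
        exact ⟨false, 1, rfl⟩
      by_cases hf : z = f
      · rw [hf]
        exact ⟨true, 1, rfl⟩
      exact ⟨i, hi.trans ⟨1, cut_next he hf⟩⟩
  · exact ⟨i, .refl _ _⟩

/-- The edges of the knot diagram whose initial pieces belong to the strand from the cut of `e` to
the cut of `f`. -/
structure IsStrand (e f : D.Edge) (U : Set D.Edge) : Prop where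
  end_mem : f ∈ U
  start_notMem : e ∉ U
  -- Closing up each strand separately replaces `next` by its composition with the transposition of
  -- `e` and `f`.
  next_mem : ∀ x, D.next (Equiv.swap e f x) ∈ U ↔ x ∈ U

/-- The edges of the tangle that belong to the strand `false`. -/
def OnStrand (U : Set D.Edge) (y : (D.cut s hef).Edge) : Prop := Sum.elim (· ∈ U) (· = false) y

theorem onStrand_passage {U : Set D.Edge} {x : D.Edge} :
    OnStrand U (passage x : (D.cut s hef).Edge) ↔ x ∈ U := Iff.rfl

theorem onStrand_endpoint {U : Set D.Edge} {i : Bool} :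
    OnStrand U (endpoint i : (D.cut s hef).Edge) ↔ i = false := Iff.rfl

theorem IsStrand.onStrand_next {U : Set D.Edge} (hU : IsStrand e f U) (y : (D.cut s hef).Edge) :
    OnStrand U ((D.cut s hef).next y) ↔ OnStrand U y := by
  rcases cut_edge_cases y with ⟨x, rfl⟩ | ⟨i, rfl⟩
  · by_cases he : x = e
    · rw [he, cut_next_start, onStrand_endpoint, onStrand_passage]
      simpa using hU.start_notMem
    by_cases hf : x = f
    · rw [hf, cut_next_end, onStrand_endpoint, onStrand_passage]
      simpa using hU.end_mem
    rw [cut_next he hf, onStrand_passage, onStrand_passage, ← hU.next_mem x,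
      Equiv.swap_apply_of_ne_of_ne he hf]
  · rw [cut_next_endpoint, onStrand_endpoint]
    cases i
    · have := (hU.next_mem f).2 hU.end_mem
      rw [Equiv.swap_apply_right] at this
      simpa [onStrand_passage] using this
    · have := (hU.next_mem e).not.2 hU.start_notMem
      rw [Equiv.swap_apply_left] at this
      simpa [onStrand_passage] using this

theorem IsStrand.onStrand_iff {U : Set D.Edge} (hU : IsStrand e f U) {y z : (D.cut s hef).Edge}
    (h : (D.cut s hef).next.SameCycle y z) : OnStrand U y ↔ OnStrand U z := by
  obtain ⟨n, rfl⟩ := h.exists_nat_pow_eq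
  clear h
  induction n with
  | zero => rfl
  | succ n ih => rw [ih, pow_succ', Equiv.Perm.mul_apply, hU.onStrand_next]

/-- Every edge is on the cycle of one of the two endpoints, and membership in `U` tells which one.
-/
theorem IsStrand.sameCycle_iff {U : Set D.Edge} (hU : IsStrand e f U)
    (h : ∀ x y, D.next.SameCycle x y) (x y : D.Edge) :
    (D.cut s hef).next.SameCycle (passage x) (passage y) ↔ (x ∈ U ↔ y ∈ U) := by
  refine ⟨hU.onStrand_iff, fun hxy => ?_⟩
  obtain ⟨i, hi⟩ := exists_strand (s := s) (hef := hef) h (passage x)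
  obtain ⟨j, hj⟩ := exists_strand (s := s) (hef := hef) h (passage y)
  have hix : i = false ↔ x ∈ U := hU.onStrand_iff hi
  have hjy : j = false ↔ y ∈ U := hU.onStrand_iff hj
  have hij : i = j := by
    rw [← hix, ← hjy] at hxy
    cases i <;> cases j <;> simp_all
  subst hij
  exact hi.symm.trans hj

theorem not_sameCycle_strands (h : ∀ x y, D.next.SameCycle x y) :
    ¬ (D.cut s hef).next.SameCycle (endpoint false) (endpoint true) := by
  obtain ⟨U, hf, he, hU⟩ := exists_separating D.next hef (h e f)
  intro hs
  have := IsStrand.onStrand_iff (U := U) ⟨hf, he, hU⟩ hs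
  simp [onStrand_endpoint] at this

theorem cutBoundary_cyclic (s : Bool) (a b : Bool × Bool) : (cutBoundary s).SameCycle a b := by
  have : ∀ s a b, ∃ n : Fin 4, (cutBoundary s)^[n] a = b := by decide
  obtain ⟨n, hn⟩ := this s a b
  exact ⟨n, by rw [zpow_natCast, Equiv.Perm.coe_pow]; exact hn⟩

/-! The boundary walk of the tangle -/

/-- The piece of an old edge with which a walk along this edge begins. -/
def cutFirstDart : D.Edge × Bool → (D.cut s hef).Edge × Bool
  | (x, true) => (passage x, true)
  | (x, false) => (lastCutPiece x, false)

/-- The piece of an old edge with which a walk along this edge ends. -/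
def cutLastDart : D.Edge × Bool → (D.cut s hef).Edge × Bool
  | (x, true) => (lastCutPiece x, true)
  | (x, false) => (passage x, false)

theorem cut_faceStep_of_next {x : (D.cut s hef).Edge} {y : D.Edge}
    (h : (D.cut s hef).next x = passage y) : (D.cut s hef).faceStep (x, true) =
      if CrossedLeftward D.sign y then (passage (other y), true)
        else (lastCutPiece (D.next.symm (other y)), false) := by
  rw [passage] at h
  simp only [TangleCode.faceStep, h]
  rfl

theorem cut_faceStep_of_next_endpoint {x : (D.cut s hef).Edge} {i : Bool}
    (h : (D.cut s hef).next x = endpoint i) :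
    (D.cut s hef).faceStep (x, true) = (D.cut s hef).enter (cutBoundary s (i, false)) := by
  rw [endpoint] at h
  simp only [TangleCode.faceStep, h]
  rfl

theorem cut_faceStep_endpoint (i : Bool) : (D.cut s hef).faceStep (endpoint i, false) =
    (D.cut s hef).enter (cutBoundary s (i, true)) := rfl

theorem cut_faceStep_passage (y : D.Edge) :
    (D.cut s hef).faceStep (passage y, false) = if CrossedLeftward D.sign y then
      (lastCutPiece (D.next.symm (other y)), false) else (passage (other y), true) := rfl

theorem faceStep_cutLastDart (z : D.Edge × Bool) :
    (D.cut s hef).faceStep (cutLastDart z) = cutFirstDart (D.faceStep z) := by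
  obtain ⟨x, _ | _⟩ := z
  · by_cases h : CrossedLeftward D.sign x
    · rw [faceStep_false_of_pos h, cutLastDart, cut_faceStep_passage, if_pos h, cutFirstDart]
    · rw [faceStep_false_of_neg h, cutLastDart, cut_faceStep_passage, if_neg h, cutFirstDart]
  · rw [cutLastDart, cut_faceStep_of_next (cut_next_lastCutPiece x)]
    by_cases h : CrossedLeftward D.sign (D.next x)
    · rw [faceStep_true_of_pos h, if_pos h, cutFirstDart]
    · rw [faceStep_true_of_neg h, if_neg h, cutFirstDart]

theorem cut_enter (i b : Bool) : (D.cut s hef).enter (i, b) =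
    if b then (endpoint i, true) else (if i then passage e else passage f, false) := by
  cases b <;> rfl

theorem cutBoundary_apply (i b : Bool) : cutBoundary s (i, b) = (!i, (i == b) == s) := rfl

theorem cutBoundary_start (s : Bool) : cutBoundary s (true, false) = (false, true) ∨
    cutBoundary s (false, true) = (true, false) := by revert s; decide

theorem cutBoundary_end (s : Bool) : cutBoundary s (false, false) = (true, true) ∨
    cutBoundary s (true, true) = (false, false) := by revert s; decide

/-- A walk along `e` on the common face reaches the boundary circle at the cut and follows it to the
cut of `f`. Here too the successors of two darts are interchanged. -/
theorem faceStep_cutFirstDart_start :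
    (D.cut s hef).faceStep (cutFirstDart (e, s)) = cutLastDart (f, !s) := by
  cases s <;>
    simp [cutFirstDart, cutLastDart, lastCutPiece_start, lastCutPiece_end, cut_faceStep_endpoint,
      cut_faceStep_of_next_endpoint cut_next_start, cutBoundary_apply, cut_enter]

theorem faceStep_cutFirstDart_end :
    (D.cut s hef).faceStep (cutFirstDart (f, !s)) = cutLastDart (e, s) := by
  cases s <;>
    simp [cutFirstDart, cutLastDart, lastCutPiece_start, lastCutPiece_end, cut_faceStep_endpoint,
      cut_faceStep_of_next_endpoint cut_next_end, cutBoundary_apply, cut_enter]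

/-- On its other side, the walk follows the boundary circle only from one end of the cut to the
other and continues along the same edge. -/
theorem faceStep_cutFirstDart_start_not :
    (D.cut s hef).faceStep (cutFirstDart (e, !s)) = cutLastDart (e, !s) := by
  cases s <;>
    simp [cutFirstDart, cutLastDart, lastCutPiece_start, cut_faceStep_endpoint,
      cut_faceStep_of_next_endpoint cut_next_start, cutBoundary_apply, cut_enter]

theorem faceStep_cutFirstDart_end_not :
    (D.cut s hef).faceStep (cutFirstDart (f, s)) = cutLastDart (f, s) := by
  cases s <;>
    simp [cutFirstDart, cutLastDart, lastCutPiece_end, cut_faceStep_endpoint,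
      cut_faceStep_of_next_endpoint cut_next_end, cutBoundary_apply, cut_enter]

theorem cutDart_cases (y : (D.cut s hef).Edge × Bool) :
    (∃ z, y = cutFirstDart z) ∨ ∃ z, y = cutLastDart z := by
  obtain ⟨x, b⟩ := y
  rcases cut_edge_cases x with ⟨x, rfl⟩ | ⟨i, rfl⟩
  · cases b
    · exact .inr ⟨(x, false), rfl⟩
    · exact .inl ⟨(x, true), rfl⟩
  · cases b <;> cases i
    · exact .inl ⟨(e, false), by rw [cutFirstDart, lastCutPiece_start]⟩
    · exact .inl ⟨(f, false), by rw [cutFirstDart, lastCutPiece_end]⟩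
    · exact .inr ⟨(e, true), by rw [cutLastDart, lastCutPiece_start]⟩
    · exact .inr ⟨(f, true), by rw [cutLastDart, lastCutPiece_end]⟩

theorem cutFirstDart_cases (z : D.Edge × Bool) :
    z = (e, s) ∨ z = (f, !s) ∨ (z ≠ (e, s) ∧ z ≠ (f, !s) ∧
      ((D.cut s hef).faceStep (cutFirstDart z) = cutLastDart z ∨
        (cutFirstDart z : (D.cut s hef).Edge × Bool) = cutLastDart z)) := by
  obtain ⟨x, b⟩ := z
  by_cases he : x = e
  · subst he
    by_cases hb : b = s
    · simp [hb]
    · simp [Bool.eq_not_of_ne hb, hef, faceStep_cutFirstDart_start_not]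
  by_cases hf : x = f
  · subst hf
    by_cases hb : b = s
    · simp [hb, hef.symm, faceStep_cutFirstDart_end_not]
    · simp [Bool.eq_not_of_ne hb]
  refine .inr (.inr ⟨by simp [he], by simp [hf], .inr ?_⟩)
  cases b <;> simp [cutFirstDart, cutLastDart, lastCutPiece_of_ne he hf]

/-- The orbit of the switched walk to which a dart of the tangle belongs. -/
def cutDartOrbit : (D.cut s hef).Edge × Bool → Orbits (D.switchedStep e f s !s)
  | (.inl x, true) => .mk _ (x, true)
  | (.inl x, false) => .mk _ (D.faceStep (x, false))
  | (.inr i, true) => .mk _ (D.faceStep (if i then f else e, true))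
  | (.inr i, false) => .mk _ (if i then f else e, false)

theorem cutDartOrbit_cutLastDart (z : D.Edge × Bool) :
    cutDartOrbit (cutLastDart z : (D.cut s hef).Edge × Bool) = .mk _ (D.faceStep z) := by
  obtain ⟨x, _ | _⟩ := z
  · rfl
  · by_cases he : x = e
    · subst he
      rw [cutLastDart, lastCutPiece_start]; rfl
    by_cases hf : x = f
    · subst hf
      rw [cutLastDart, lastCutPiece_end]; rfl
    rw [orbit_faceStep, cutLastDart, lastCutPiece_of_ne he hf]
    · rfl
    · exact fun h => he (congrArg Prod.fst h)
    · exact fun h => hf (congrArg Prod.fst h)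

theorem cutDartOrbit_cutFirstDart (z : D.Edge × Bool) :
    cutDartOrbit (cutFirstDart z : (D.cut s hef).Edge × Bool) = .mk _ z := by
  obtain ⟨x, _ | _⟩ := z
  · by_cases he : x = e
    · subst he
      rw [cutFirstDart, lastCutPiece_start]; rfl
    by_cases hf : x = f
    · subst hf
      rw [cutFirstDart, lastCutPiece_end]; rfl
    rw [cutFirstDart, lastCutPiece_of_ne he hf]
    refine (cutDartOrbit_cutLastDart (x, false)).trans (orbit_faceStep ?_ ?_)
    · exact fun h => he (congrArg Prod.fst h)
    · exact fun h => hf (congrArg Prod.fst h)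
  · rfl

theorem cutDartOrbit_faceStep (y : (D.cut s hef).Edge × Bool) :
    cutDartOrbit ((D.cut s hef).faceStep y) = cutDartOrbit y := by
  have hlast : ∀ z, cutDartOrbit ((D.cut s hef).faceStep (cutLastDart z)) =
      cutDartOrbit (cutLastDart z : (D.cut s hef).Edge × Bool) := by
    intro z
    rw [faceStep_cutLastDart, cutDartOrbit_cutFirstDart, cutDartOrbit_cutLastDart]
  rcases cutDart_cases y with ⟨z, rfl⟩ | ⟨z, rfl⟩
  · rcases cutFirstDart_cases (s := s) (hef := hef) z with rfl | rfl | ⟨h1, h2, h | h⟩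
    · rw [faceStep_cutFirstDart_start, cutDartOrbit_cutLastDart, cutDartOrbit_cutFirstDart,
        ← switchedStep_over (p := e) (s := s), Orbits.mk_apply]
    · rw [faceStep_cutFirstDart_end, cutDartOrbit_cutLastDart, cutDartOrbit_cutFirstDart,
        ← switchedStep_under (q := f) (t := !s), Orbits.mk_apply]
    · rw [h, cutDartOrbit_cutLastDart, cutDartOrbit_cutFirstDart, orbit_faceStep h1 h2]
    · rw [h]; exact hlast z
  · exact hlast z

theorem orbit_cutFirstDart_switchedStep (z : D.Edge × Bool) :
    Orbits.mk (D.cut s hef).faceStep (cutFirstDart (D.switchedStep e f s (!s) z)) =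
      Orbits.mk _ (cutFirstDart z) := by
  rcases cutFirstDart_cases (s := s) (hef := hef) z with rfl | rfl | ⟨h1, h2, h⟩
  · rw [switchedStep_over, ← faceStep_cutLastDart, ← faceStep_cutFirstDart_start]
    simp only [Orbits.mk_apply]
  · rw [switchedStep_under, ← faceStep_cutLastDart, ← faceStep_cutFirstDart_end]
    simp only [Orbits.mk_apply]
  · rw [switchedStep_of_ne h1 h2, ← faceStep_cutLastDart, Orbits.mk_apply]
    rcases h with h | h
    · rw [← h, Orbits.mk_apply]
    · rw [h]

/-- The removed disc reaches across the common face from `e` to `f` and divides it into two regions;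
there is no bigon here. -/
theorem card_face_cut (h : D.facePerm.SameCycle (e, s) (f, !s)) :
    Nat.card (D.cut s hef).Face = Nat.card D.Face + 1 := by
  have h1 : Nat.card (Orbits (D.cut s hef).faceStep) =
      Nat.card (Orbits (D.switchedStep e f s !s)) := by
    refine Orbits.card_eq cutDartOrbit cutDartOrbit_faceStep
      (fun z => Orbits.mk _ (cutFirstDart z)) orbit_cutFirstDart_switchedStep
      (fun z => cutDartOrbit_cutFirstDart z) fun y => ?_
    rcases cutDart_cases y with ⟨z, rfl⟩ | ⟨z, rfl⟩
    · rw [cutDartOrbit_cutFirstDart]; rfl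
    · rw [cutDartOrbit_cutLastDart, Orbits.lift_mk, ← faceStep_cutLastDart, Orbits.mk_apply]
  have h2 : Nat.card (Orbits (D.switchedStep e f s !s)) = Nat.card (Orbits D.faceStep) + 1 :=
    card_orbits_comp_swap D.facePerm (fun heq => hef (congrArg Prod.fst heq)) h
  exact h1.trans h2

end Cut
end GaussCode

/-! ### The tangle diagram and its linking number -/

namespace KnotDiagram

open GaussCode

variable (D : KnotDiagram) {e f : D.Edge} (s : Bool) (hef : e ≠ f)

/-- The tangle diagram that arises when `e` and `f` are cut at a common face along which they run
in opposite directions. -/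
def cut (h : D.facePerm.SameCycle (e, s) (f, !s)) : TwoTangleDiagram where
  toTangleCode := D.toGaussCode.cut s hef
  two_strands := not_sameCycle_strands D.one_component
  no_closed_component := exists_strand D.one_component
  boundary_cyclic := cutBoundary_cyclic s
  planar := by
    -- The collapsed boundary circle is one more vertex; there are two more edges and one more face.
    rw [card_face_cut h]
    have := D.planar
    change Fintype.card D.Crossing + 1 + _ = Fintype.card ((D.Crossing × Bool) ⊕ Bool) + 2
    simp only [Fintype.card_sum, Fintype.card_prod, Fintype.card_bool] at this ⊢
    omega

variable {s hef} {h : D.facePerm.SameCycle (e, s) (f, !s)}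

/-- The tangle `D.cut s hef h` arises from `D` by cutting `e` and `f`. -/
def isCut_cut : IsCut D e f (D.cut s hef h) where
  equiv := Equiv.refl _
  sign_equiv _ := rfl
  start_false := rfl
  end_false := cut_next_end (hef := hef)
  start_true := rfl
  end_true := cut_next_start (hef := hef)
  next_equiv _ he hf := cut_next (hef := hef) he hf
  adjacent_e := cutBoundary_start s
  adjacent_f := cutBoundary_end s

open Classical in
-- The crossings that count are those with exactly one passage in `U`, so an explicit `U` suffices
-- for the computation.
theorem linkingNumber_cut {U : Set D.Edge} (hU : IsStrand e f U) :
    (D.cut s hef h).linkingNumber =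
      (∑ c : D.Crossing, if ((c, true) ∈ U ↔ (c, false) ∈ U) then 0
        else ((D.sign c : ℤ) : ℚ)) / 2 := by
  rw [TwoTangleDiagram.linkingNumber]
  congr 1
  refine Finset.sum_congr rfl fun c _ => ?_
  exact if_congr (hU.sameCycle_iff (s := s) (hef := hef) D.one_component (c, true) (c, false))
    rfl rfl

end KnotDiagram

/-! ### The two moves and the cut -/

open GaussCode

/-- Three consecutive edges form a strand that begins at a cut of the edge before them and ends at
a cut of the last one. -/
theorem GaussCode.isStrand_of_next {D : GaussCode} {e a b f : D.Edge} (ha : D.next e = a)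
    (hb : D.next a = b) (hf : D.next b = f) (hea : a ≠ e) (heb : b ≠ e) (hef : f ≠ e)
    (haf : a ≠ f) (hbf : b ≠ f) : IsStrand e f {a, b, f} where
  end_mem := by simp
  start_notMem := by simp [hea.symm, heb.symm, hef.symm]
  next_mem x := by
    have h1 : ∀ y, D.next y ∈ ({a, b, f} : Set D.Edge) ↔ y = e ∨ y = a ∨ y = b := by
      intro y
      simp only [Set.mem_insert_iff, Set.mem_singleton_iff]
      nth_rw 1 [← ha]
      nth_rw 1 [← hb]
      nth_rw 1 [← hf]
      simp only [EmbeddingLike.apply_eq_iff_eq]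
    rw [h1]
    simp only [Set.mem_insert_iff, Set.mem_singleton_iff]
    by_cases hxe : x = e
    · rw [hxe, Equiv.swap_apply_left]
      simp [hef, haf.symm, hbf.symm, hea.symm, heb.symm, hef.symm]
    by_cases hxf : x = f
    · rw [hxf, Equiv.swap_apply_right]; simp
    rw [Equiv.swap_apply_of_ne_of_ne hxe hxf]
    simp [hxe, hxf]

namespace GaussCode

variable {D : GaussCode} {p q : D.Edge} {s t : Bool} {hpq : p ≠ q}

theorem lastPiece_under_ne_old (x : D.Edge) :
    (lastPiece q : (D.push s t hpq).Edge) ≠ old x := by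
  rw [lastPiece_under]
  intro h
  cases congrArg Prod.fst h

theorem new_ne_old (i b : Bool) (x : D.Edge) : (new i b : (D.push s t hpq).Edge) ≠ old x := by
  intro h
  cases congrArg Prod.fst h

theorem new_inj {i b j c : Bool} :
    (new i b : (D.push s t hpq).Edge) = new j c ↔ i = j ∧ b = c := by
  constructor
  · intro h
    obtain ⟨h1, h2⟩ := Prod.mk.inj h
    exact ⟨Sum.inr_injective h1, h2⟩
  · rintro ⟨rfl, rfl⟩; rfl

theorem sum_crossing_push (F : (D.push s t hpq).Crossing → ℚ) :
    ∑ c, F c = ∑ c : D.Crossing, F (.inl c) + (F (.inr true) + F (.inr false)) :=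
  (Fintype.sum_sum_type F).trans (congrArg _ (Fintype.sum_bool _))

/-- After `p` has been pushed over `q`, both outer pieces of `q` are on the face into which `p` has
been pushed. -/
theorem sameCycle_lastPiece_old : (D.push s t hpq).facePerm.SameCycle
    (lastPiece q, !t) (old q, !t) := by
  have h : (D.push s t hpq).facePerm.SameCycle (firstDart (q, !t)) (lastDart (q, !t)) := by
    refine ⟨2, ?_⟩
    change (D.push s t hpq).faceStep ((D.push s t hpq).faceStep (firstDart (q, !t))) = _
    rw [faceStep_firstDart_under_not, faceStep_midOver]
  -- Which outer piece comes first on the walk depends on its direction.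
  cases t
  · exact h.symm
  · exact h

/-- If `p` and `q` run in the same direction along their common face, then the last piece of `q` is
adjacent to the middle piece of `p`. -/
theorem sameCycle_lastPiece_midOver {hpq : p ≠ q} :
    (D.push s s hpq).facePerm.SameCycle (lastPiece q, !s) (midOver, !!s) := by
  cases s
  · have h : (D.push false false hpq).faceStep (midOver, false) = (lastPiece q, true) :=
      faceStep_midOver
    exact Equiv.Perm.SameCycle.symm ⟨1, h⟩
  · have h : (D.push true true hpq).faceStep (lastPiece q, false) = (midOver, true) :=
      faceStep_firstDart_under_not (s := true) (t := true)
    exact ⟨1, h⟩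

end GaussCode

variable {X : Type*} [Quandle X]

open Classical in
/-- Any edge of a colored diagram gives, after two moves, rise to two arcs of the same color that can
be cut into a tangle with linking number `1 / 2` or `-1 / 2`. -/
theorem exists_moves_of_edge (K : ColoredDiagram X) (e₀ : K.diagram.Edge) :
    ∃ K' : ColoredDiagram X,
      Relation.ReflTransGen ColoredR2Move K K' ∧ (K.IsNontrivial → K'.IsNontrivial) ∧
      ∃ e f : K'.diagram.Edge, K'.diagram.arcOf e ≠ K'.diagram.arcOf f ∧
        K'.edgeColor e = K.edgeColor e₀ ∧ K'.edgeColor f = K.edgeColor e₀ ∧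
        ∃ T : TwoTangleDiagram,
          Nonempty (IsCut K'.diagram e f T) ∧ T.linkingNumber ≠ 0 := by
  -- An edge cannot be pushed over itself, so the side of `e₀` is chosen where the next edge of the
  -- face is different.
  obtain ⟨t, ht⟩ := K.diagram.exists_faceStep_ne e₀
  obtain ⟨⟨g, s⟩, hg⟩ : ∃ z, K.diagram.faceStep (e₀, t) = z := ⟨_, rfl⟩
  rw [hg] at ht
  have hge : g ≠ e₀ := ht
  have hface : K.diagram.facePerm.SameCycle (g, s) (e₀, t) :=
    Equiv.Perm.SameCycle.symm ⟨1, hg⟩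
  let K₁ := K.push s t hge hface
  let p : K₁.diagram.Edge := (lastPiece e₀ : (K.diagram.toGaussCode.push s t hge).Edge)
  let q : K₁.diagram.Edge := (old e₀ : (K.diagram.toGaussCode.push s t hge).Edge)
  let m : K₁.diagram.Edge := (midUnder : (K.diagram.toGaussCode.push s t hge).Edge)
  have hpq : p ≠ q := lastPiece_under_ne_old (hpq := hge) e₀
  have hpm : m ≠ p := by
    change (midUnder : (K.diagram.toGaussCode.push s t hge).Edge) ≠ lastPiece e₀
    rw [midUnder, lastPiece_under, Ne, new_inj]
    simp
  have hqm : m ≠ q := new_ne_old (hpq := hge) _ _ e₀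
  have hnq : K₁.diagram.next q = m := next_old_under (hpq := hge)
  have hnm : K₁.diagram.next m = p := (next_midUnder (hpq := hge)).trans lastPiece_under.symm
  have hface₁ : K₁.diagram.facePerm.SameCycle (p, !t) (q, !t) :=
    sameCycle_lastPiece_old (hpq := hge)
  -- As pieces of `e₀`, the edges `p` and `q` run in the same direction along the face, hence the
  -- same `!t` twice. This puts `e` and `f` on a common face in opposite directions, as the cut
  -- requires.
  let D₂ := K₁.diagram.toGaussCode.push (!t) (!t) hpq
  let K₂ := K₁.push (!t) (!t) hpq hface₁
  have hlast : (lastPiece q : D₂.Edge) = new false false := by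
    rw [lastPiece_under]; simp
  let e : K₂.diagram.Edge := (lastPiece q : D₂.Edge)
  let f : K₂.diagram.Edge := (midOver : D₂.Edge)
  have hef : e ≠ f := by
    change (lastPiece q : D₂.Edge) ≠ midOver
    rw [hlast, midOver, Ne, new_inj]
    simp
  have hne : D₂.next (lastPiece q) = old m := by rw [next_lastPiece, hnq]
  have hno : D₂.next (old m) = old p := by rw [next_old hpm hqm, hnm]
  have hnp : D₂.next (old p) = midOver := next_old_over
  -- The strand from `e` to `f` has three passages: the starting points of `old m`, `old p` and `f`.
  have hstrand : IsStrand (D := D₂) e f {old m, old p, f} :=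
    isStrand_of_next (D := D₂) hne hno hnp (lastPiece_under_ne_old _).symm
      (lastPiece_under_ne_old _).symm hef.symm (new_ne_old _ _ _).symm (new_ne_old _ _ _).symm
  have hface₂ : K₂.diagram.facePerm.SameCycle (e, !!t) (f, !!!t) :=
    sameCycle_lastPiece_midOver (s := !t) (hpq := hpq)
  refine ⟨K₂, .tail (.single K.coloredR2Move_push) K₁.coloredR2Move_push,
    fun h => K₁.push_isNontrivial (K.push_isNontrivial h), e, f, ?_, ?_, ?_,
    K₂.diagram.cut (!!t) hef hface₂, ⟨K₂.diagram.isCut_cut⟩, ?_⟩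
  -- The passages at both ends of `e` are under-passages, so `e` alone is an arc.
  · refine arcOf_ne (D := D₂) (· = lastPiece q) (fun x hx => ?_) rfl hef.symm
    constructor
    · intro h
      rw [h, hlast] at hx
      cases hx
    · intro h
      rw [h, hne] at hx
      cases hx
  · exact K₁.pushColor_lastPiece q
  · exact K.pushColor_lastPiece e₀
  · have hold : ∀ c b, ((.inl (.inl c), b) : D₂.Edge) ∉ ({old m, old p, f} : Set D₂.Edge) := by
      rintro c b (h | h | h)
      · exact new_ne_old (hpq := hge) _ _ (c, b) (old_injective h).symm
      · exact lastPiece_under_ne_old (hpq := hge) (c, b) (old_injective h).symm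
      · exact new_ne_old _ _ (D := K₁.diagram.toGaussCode) (.inl c, b) h.symm
    -- The edges `m` and `p` start at the under-passages of the two crossings of the first move.
    have hmid : ∀ i b, ((.inl (.inr i), b) : D₂.Edge) ∈ ({old m, old p, f} : Set D₂.Edge) ↔
        b = false := by
      intro i b
      have h1 : ((.inl (.inr i), b) : D₂.Edge) = old m ↔ i = (s == t) ∧ b = false :=
        old_injective.eq_iff.trans (new_inj (hpq := hge))
      have h2 : ((.inl (.inr i), b) : D₂.Edge) = old p ↔ i = (!(s == t)) ∧ b = false :=
        old_injective.eq_iff.trans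
          ((lastPiece_under (hpq := hge) (s := s) (t := t)).congr_right.trans (new_inj (hpq := hge)))
      have h3 : ((.inl (.inr i), b) : D₂.Edge) ≠ f := fun h =>
        new_ne_old _ _ (D := K₁.diagram.toGaussCode) (.inr i, b) h.symm
      refine (h1.or (h2.or (iff_false_intro h3))).trans ?_
      cases i <;> cases s <;> cases t <;> simp
    have hnew : ∀ j b, ((.inr j, b) : D₂.Edge) ∈ ({old m, old p, f} : Set D₂.Edge) ↔
        j = false ∧ b = true := by
      intro j b
      have h1 : ∀ x, ((.inr j, b) : D₂.Edge) ≠ old x := fun x => new_ne_old j b x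
      have h2 : ((.inr j, b) : D₂.Edge) = f ↔ j = false ∧ b = true := new_inj
      refine ((iff_false_intro (h1 m)).or ((iff_false_intro (h1 p)).or h2)).trans ?_
      simp
    generalize ({old m, old p, f} : Set D₂.Edge) = U at hold hmid hnew hstrand
    rw [K₂.diagram.linkingNumber_cut hstrand]
    -- Contributions of the crossings: none from those of `K`, opposite signs from the first move,
    -- and from the second move only the crossing at which `f` starts. The second push has side
    -- `!t`, so this crossing is negative exactly if `t` is true.
    let G : D₂.Crossing → ℚ := Sum.elim (Sum.elim (fun _ => 0) fun i => if i = t then -1 else 1)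
      fun j => if j then 0 else if t then -1 else 1
    have hG : ∑ c, G c = if t then -1 else 1 := by
      refine (sum_crossing_push G).trans ?_
      refine (congrArg (· + _) (sum_crossing_push (hpq := hge) fun c => G (.inl c))).trans ?_
      change (∑ c : K.diagram.Crossing, (0 : ℚ)) + ((if true = t then -1 else 1) +
        if false = t then -1 else 1) + (0 + if t then -1 else 1) = if t then -1 else 1
      cases t <;> simp
    have hterm : ∀ c : D₂.Crossing, (if ((c, true) ∈ U ↔ (c, false) ∈ U) then 0
        else ((D₂.sign c : ℤ) : ℚ)) = G c := by
      rintro ((c | i) | j)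
      · exact if_pos (iff_of_false (hold c true) (hold c false))
      · refine (if_neg fun h => ?_).trans ?_
        · cases (hmid i true).1 (h.2 ((hmid i false).2 rfl))
        · change (((if i = t then -1 else 1 : ℤˣ) : ℤ) : ℚ) = if i = t then -1 else 1
          split_ifs <;> simp
      · cases j
        · refine (if_neg fun h => ?_).trans ?_
          · cases ((hnew false false).1 (h.1 ((hnew false true).2 ⟨rfl, rfl⟩))).2
          · change (((if false = !t then -1 else 1 : ℤˣ) : ℤ) : ℚ) = if t then -1 else 1
            cases t <;> simp
        · refine if_pos (iff_of_false (fun h => ?_) fun h => ?_)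
          · cases ((hnew true true).1 h).1
          · cases ((hnew true false).1 h).1
    have hsum := (Finset.sum_congr rfl fun c _ => hterm c).trans hG
    intro h0
    have h1 := hsum.symm.trans ((div_eq_zero_iff.1 h0).resolve_right two_ne_zero)
    cases t <;> simp at h1

end KnotTangle

theorem corollary3p2 {X : Type*} [Quandle X] (K : KnotTangle.ColoredDiagram X)
    (hK : K.IsNontrivial) (a b : K.diagram.Arc) (hab : a ≠ b) (hcol : K.color a = K.color b) :
    ∃ K' : KnotTangle.ColoredDiagram X,
      Relation.ReflTransGen KnotTangle.ColoredR2Move K K' ∧ K'.IsNontrivial ∧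
      ∃ a' b' : K'.diagram.Arc, a' ≠ b' ∧
        K'.color a' = K.color a ∧ K'.color b' = K.color a ∧
        ∃ e f : K'.diagram.Edge, K'.diagram.arcOf e = a' ∧ K'.diagram.arcOf f = b' ∧
          ∃ T : KnotTangle.TwoTangleDiagram,
            Nonempty (KnotTangle.IsCut K'.diagram e f T) ∧ T.linkingNumber ≠ 0 := by
  obtain ⟨e₀, rfl⟩ : ∃ e₀, K.diagram.arcOf e₀ = a := Quot.exists_rep a
  obtain ⟨K', hmoves, hnon, e, f, hne, he, hf, hT⟩ := KnotTangle.exists_moves_of_edge K e₀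
  exact ⟨K', hmoves, hnon hK, _, _, hne, he, hf, e, f, rfl, rfl, hT⟩
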